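/- Let $C\in\mathbb R^{d\times d}$ be symmetric positive definite, and let $\bar p_0\in C^2(\mathbb R^d)$ be a probability density with $\mathbb E_{\bar p_0}|X|^3<\infty$. Assume (Gaussian tail) that $\bar p_0(x)=\exp(-|x|_A^2/2)\exp(h(x))$, where $|x|_A^2=(A^{-1/2}x,A^{-1/2}x)$, $A$ is symmetric positive definite and simultaneously diagonalizable with $C$ in an orthonormal basis, and $\sup_x|\sqrt C\,\nabla h(x)|<\infty$, $\sup_x\|C\,\nabla^2h(x)\|<\infty$. For $t\in(0,1)$ let $$p_t(x)=\int_{\mathbb R^d} g_{(1-t^2)C}(x-ty)\,\bar p_0(y)\,dy,\qquad p_1=\bar p_0,$$ where $g_\Sigma$ is the density of $N(0,\Sigma)$; thus $p_t$ is the marginal density at time $1-t$ of the forward diffusion started from $\bar p_0$ with transition law $N((1-s)x_0,\,s(2-s)C)$ at time $s$. Put $S(t,x)=C\nabla\log p_t(x)$ and $$V(t,x)=\frac{x+S(t,x)}{t}\quad(0<t\le1),\qquad V(0,x)=\mathbb E_{\bar p_0}[X].$$ Then: 1. For all $t\in(0,1]$, $p_t$ is positive and differentiable on $\mathbb R^d$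 (so that $S$ and $V$ are well defined), and for every $x$, $\lim_{t\downarrow0}\frac{x+S(t,x)}{t}=\mathbb E_{\bar p_0}[X]$. Moreover, $V$, as a function on $[0,1]\times\mathbb R^d$, is continuous at every point $(0,x)$. 2. For every $x\in\mathbb R^d$ the initial value problem $\frac{d}{dt}X_t=V(t,X_t)$, $X_0=x$, has exactly one solution $t\mapsto X_t(x)$ on the closed interval $[0,1]$ (with one-sided derivatives at the endpoints). 3. The time-one map $X_1:\mathbb R^d\to\mathbb R^d$ is measurable and pushes $N(0,C)$ forward to the law with density $\bar p_0$. -/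

import Mathlib

open MeasureTheory ProbabilityTheory Filter Topology Set
open scoped MatrixOrder

noncomputable section

namespace Follmer

/-- Matrices acting on Euclidean space. -/
abbrev act {d : ℕ} (M : Matrix (Fin d) (Fin d) ℝ) :
    EuclideanSpace ℝ (Fin d) →L[ℝ] EuclideanSpace ℝ (Fin d) :=
  Matrix.toEuclideanCLM (𝕜 := ℝ) M

/-- The weighted square norm `|x|_A ^ 2 = (A^{-1/2} x, A^{-1/2} x)` of a symmetric
positive-definite matrix `A`; here `CFC.sqrt` is the positive square root. -/
def weightedNormSq {d : ℕ} (A : Matrix (Fin d) (Fin d) ℝ) (x : EuclideanSpace ℝ (Fin d)) : ℝ :=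
  inner ℝ (act (CFC.sqrt A)⁻¹ x) (act (CFC.sqrt A)⁻¹ x)

/-- For positive-definite `A` the weighted square norm is the quadratic form of `A⁻¹`. -/
theorem weightedNormSq_eq {d : ℕ} {A : Matrix (Fin d) (Fin d) ℝ} (hA : A.PosDef)
    (x : EuclideanSpace ℝ (Fin d)) :
    weightedNormSq A x = inner ℝ x (act A⁻¹ x) := by
  have hs : (CFC.sqrt A)⁻¹ * (CFC.sqrt A)⁻¹ = A⁻¹ := by
    rw [← Matrix.mul_inv_rev, CFC.sqrt_mul_sqrt_self _ hA.posSemidef.nonneg]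
  have hmul : act A⁻¹ = act (CFC.sqrt A)⁻¹ * act (CFC.sqrt A)⁻¹ := by
    rw [← hs]
    exact map_mul (Matrix.toEuclideanCLM (𝕜 := ℝ)) _ _
  have hsa : IsSelfAdjoint (act (CFC.sqrt A)⁻¹) :=
    IsSelfAdjoint.map (f := Matrix.toEuclideanCLM (𝕜 := ℝ))
      ((CFC.sqrt_nonneg A).isSelfAdjoint.isHermitian.inv)
  have h2 := (ContinuousLinearMap.isSelfAdjoint_iff_isSymmetric.mp hsa) x (act (CFC.sqrt A)⁻¹ x)
  rw [weightedNormSq, hmul]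
  exact h2

/-- The density at `x` of the centred Gaussian law `N(0, Σ)`, for `Σ` positive definite. -/
def gaussianDensity {d : ℕ} (S : Matrix (Fin d) (Fin d) ℝ) (x : EuclideanSpace ℝ (Fin d)) : ℝ :=
  (Real.sqrt ((2 * Real.pi) ^ d * S.det))⁻¹ * Real.exp (-weightedNormSq S x / 2)

/-- `p` is a probability density with respect to Lebesgue measure. -/
def IsProbDensity {d : ℕ} (p : EuclideanSpace ℝ (Fin d) → ℝ) : Prop :=
  (∀ x, 0 ≤ p x) ∧ Integrable p ∧ ∫ x, p x = 1

/-- The law with Lebesgue density `p`. -/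
def law {d : ℕ} (p : EuclideanSpace ℝ (Fin d) → ℝ) : Measure (EuclideanSpace ℝ (Fin d)) :=
  volume.withDensity fun x => ENNReal.ofReal (p x)

/-- Two matrices have a common orthonormal basis of eigenvectors. -/
def SimultaneouslyDiagonalizable {d : ℕ} (A C : Matrix (Fin d) (Fin d) ℝ) : Prop :=
  ∃ U ∈ Matrix.orthogonalGroup (Fin d) ℝ, ∃ a c : Fin d → ℝ,
    A = U * Matrix.diagonal a * U.transpose ∧ C = U * Matrix.diagonal c * U.transpose

/-- The Gaussian tail assumption on a density `p₀`, with reference covariance `C`, tail covariance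
`A` and remainder `h`. The operator norms of `A`, `C`, `A C⁻¹`, `C A⁻¹` are finite automatically,
the dimension being finite. -/
structure GaussianTail {d : ℕ} (C A : Matrix (Fin d) (Fin d) ℝ)
    (h p₀ : EuclideanSpace ℝ (Fin d) → ℝ) : Prop where
  contDiff : ContDiff ℝ 2 p₀
  decomposition : ∀ x, p₀ x = Real.exp (-weightedNormSq A x / 2) * Real.exp (h x)
  posDef : A.PosDef
  diagonalizable : SimultaneouslyDiagonalizable A C
  gradient_bounded : ∃ M : ℝ, ∀ x, ‖act (CFC.sqrt C) (gradient h x)‖ ≤ M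
  hessian_bounded : ∃ M : ℝ, ∀ x, ‖(act C).comp (fderiv ℝ (gradient h) x)‖ ≤ M

/-- The marginal density at time `s ∈ [0, 1)` of the forward diffusion
`dX = -X / (1 - s) ds + √(2 C / (1 - s)) dW`, `X₀ ∼ p₀`, whose transition law from `X₀ = y` is
`N((1 - s) y, s (2 - s) C)`. -/
def forwardDensity {d : ℕ} (C : Matrix (Fin d) (Fin d) ℝ) (p₀ : EuclideanSpace ℝ (Fin d) → ℝ)
    (s : ℝ) (x : EuclideanSpace ℝ (Fin d)) : ℝ :=
  if s = 0 then p₀ x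
  else ∫ y, gaussianDensity ((s * (2 - s)) • C) (x - (1 - s) • y) * p₀ y

/-- The time-reversed density `p_t`, for `t ∈ (0, 1]`. -/
def reverseDensity {d : ℕ} (C : Matrix (Fin d) (Fin d) ℝ) (p₀ : EuclideanSpace ℝ (Fin d) → ℝ)
    (t : ℝ) (x : EuclideanSpace ℝ (Fin d)) : ℝ :=
  forwardDensity C p₀ (1 - t) x

/-- The preconditioned score `S(t, x) = C ∇ log p_t(x)`. -/
def score {d : ℕ} (C : Matrix (Fin d) (Fin d) ℝ) (p₀ : EuclideanSpace ℝ (Fin d) → ℝ)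
    (t : ℝ) (x : EuclideanSpace ℝ (Fin d)) : EuclideanSpace ℝ (Fin d) :=
  act C (gradient (fun z => Real.log (reverseDensity C p₀ t z)) x)

/-- The Föllmer velocity field: `V(t, x) = (x + S(t, x)) / t` for `t ∈ (0, 1]`, and
`V(0, x)` is the mean of the target law. -/
def velocity {d : ℕ} (C : Matrix (Fin d) (Fin d) ℝ) (p₀ : EuclideanSpace ℝ (Fin d) → ℝ)
    (t : ℝ) (x : EuclideanSpace ℝ (Fin d)) : EuclideanSpace ℝ (Fin d) :=
  if t = 0 then ∫ y, y ∂(law p₀) else t⁻¹ • (x + score C p₀ t x)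

/-- `X` solves `X' = V(t, X)` on the closed interval `[0, 1]`, with `X 0 = x`; derivatives at the
endpoints are one-sided. -/
def IsFollmerSolution {d : ℕ} (C : Matrix (Fin d) (Fin d) ℝ) (p₀ : EuclideanSpace ℝ (Fin d) → ℝ)
    (x : EuclideanSpace ℝ (Fin d)) (X : ℝ → EuclideanSpace ℝ (Fin d)) : Prop :=
  X 0 = x ∧ ∀ t ∈ Icc (0 : ℝ) 1, HasDerivWithinAt X (velocity C p₀ t (X t)) (Icc 0 1) t

end Follmer

end

/-! The score is a posterior mean. Let Y have density p₀, let W be N(0, C) and independent of Y, and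
put X_t = t Y + √(1 - t²) W, whose density is p_t. Tweedie's formula turns V(t, x) into E[(Y - t
X_t) / (1 - t²) | X_t = x], and (Y - t X_t) / (1 - t²) is exactly dX_t/dt for t < 1. So V is the
mean velocity, conditional on position, of a random curve from W to Y.

The singularities at t = 0 and t = 1 are only apparent. With P = C⁻¹ and Q = A⁻¹, completing the
square shows that given X_t = x one has Y = m + √(1 - t²) Z, where Z has density proportional to
exp(h(m + √(1 - t²) z) - ⟨z, B z⟩ / 2), B = (1 - t²) Q + t² P and m = t B⁻¹ P x. Integration by
parts gives B E[Z] = √(1 - t²) E[∇h(Y)], whence V(t, x) = B⁻¹ (t (P - Q) x + E[∇h(Y) | X_t = x]);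
this is `drift`, identified with V in `velocity_eq_drift`. Since B is bounded below uniformly in t,
and ∇h is bounded and Lipschitz, the field is jointly continuous up to both endpoints and Lipschitz
in x uniformly in t (`continuous_drift`, `norm_drift_sub_le`). The limit at 0, the continuity there,
and existence and uniqueness of the flow follow.

For the push-forward, let Φ be the flow, f bounded and Lipschitz, and u_t(x) = f(Φ(t, x, 1)). This u
is constant along the flow, and X_t has the same mean velocity as the flow, so E[u_t(X_t)] is
constant; it equals E[f(Φ(0, W, 1))] at t = 0 and E[f(Y)] at t = 1. As u_t is only Lipschitz, it is
mollified at radius δ. Mollification commutes with the flow over [t, s] up to O(δ (s - t)), so the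
total change over [0, 1] is O(δ), and δ → 0 (`integral_terminal_eq`). Characters as f identify the
two laws. -/

namespace Follmer

/-! ### Flows of globally Lipschitz time-dependent fields -/

section Flow

variable {E : Type*} [NormedAddCommGroup E] [NormedSpace ℝ E]

/-- `Φ s x` is, for `s ∈ [0, 1]`, the solution on `[s, 1]` of the equation `y' = v(t, y)` started
from `x` at time `s`. -/
structure IsFlow (v : ℝ → E → E) (Φ : ℝ → E → ℝ → E) : Prop where
  init : ∀ s ∈ Icc (0 : ℝ) 1, ∀ x, Φ s x s = x
  deriv : ∀ s ∈ Icc (0 : ℝ) 1, ∀ x, ∀ t ∈ Icc s 1,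
    HasDerivWithinAt (Φ s x) (v t (Φ s x t)) (Icc s 1) t

theorem norm_le_of_lipschitzWith {E : Type*} [SeminormedAddCommGroup E] {v : ℝ → E → E}
    {K : NNReal} {A : ℝ}
    (hK : ∀ t, LipschitzWith K (v t)) (hA : ∀ t, ‖v t 0‖ ≤ A) (t : ℝ) (x : E) :
    ‖v t x‖ ≤ A + K * ‖x‖ := by
  have h1 := (hK t).dist_le_mul x 0
  rw [dist_eq_norm, dist_zero_right] at h1
  have h2 := norm_sub_norm_le (v t x) (v t 0)
  linarith [hA t]

theorem exists_solution_of_short [CompleteSpace E] {v : ℝ → E → E} {K : NNReal} {A : ℝ}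
    (hv : Continuous (Function.uncurry v))
    (hK : ∀ t, LipschitzWith K (v t)) (hA : ∀ t, ‖v t 0‖ ≤ A) {a b : ℝ} (hab : a ≤ b)
    (hshort : (b - a) * (2 * K) ≤ 1) (x : E) :
    ∃ α : ℝ → E, α a = x ∧ ∀ t ∈ Icc a b, HasDerivWithinAt α (v t (α t)) (Icc a b) t := by
  have hA0 : 0 ≤ A := (norm_nonneg _).trans (hA 0)
  have hba : 0 ≤ b - a := sub_nonneg.2 hab
  have hK0 : (0 : ℝ) ≤ K := K.2
  -- On the ball of radius R the speed is at most A + K (‖x‖ + R), so the displacement is at most R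
  -- / 2 + K (b - a) R. Shortness makes the second term at most R / 2, and the curve stays in the
  -- ball.
  set R : ℝ := 2 * (A + K * ‖x‖) * (b - a) with hR
  have hR0 : 0 ≤ R := by positivity
  have hL0 : 0 ≤ A + K * (‖x‖ + R) := by positivity
  have hPL : IsPicardLindelof v (tmin := a) (tmax := b) ⟨a, left_mem_Icc.2 hab⟩ x ⟨R, hR0⟩ 0
      ⟨A + K * (‖x‖ + R), hL0⟩ K := by
    refine ⟨fun t _ => (hK t).lipschitzOnWith, fun y _ => ?_, fun t _ y hy => ?_, ?_⟩
    · exact (hv.comp (Continuous.prodMk_left y)).continuousOn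
    · refine (norm_le_of_lipschitzWith hK hA t y).trans ?_
      have : ‖y‖ ≤ ‖x‖ + R := by
        have h1 : dist y x ≤ R := hy
        rw [dist_eq_norm] at h1
        linarith [norm_sub_norm_le y x]
      change A + K * ‖y‖ ≤ A + K * (‖x‖ + R)
      gcongr
    · change (A + K * (‖x‖ + R)) * max (b - a) (a - a) ≤ R - 0
      rw [sub_self, max_eq_left hba]
      nlinarith
  exact hPL.exists_eq_forall_mem_Icc_hasDerivWithinAt₀

theorem exists_solution_glue {v : ℝ → E → E} {a m b : ℝ} (ham : a ≤ m) (hmb : m ≤ b)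
    {α β : ℝ → E} (hαβ : β m = α m)
    (hα : ∀ t ∈ Icc a m, HasDerivWithinAt α (v t (α t)) (Icc a m) t)
    (hβ : ∀ t ∈ Icc m b, HasDerivWithinAt β (v t (β t)) (Icc m b) t) :
    ∃ γ : ℝ → E, γ a = α a ∧ ∀ t ∈ Icc a b, HasDerivWithinAt γ (v t (γ t)) (Icc a b) t := by
  set γ : ℝ → E := fun t => if t ≤ m then α t else β t with hγ
  have h1 : ∀ t ∈ Icc a m, γ t = α t := fun t ht => by simp [hγ, ht.2]
  have h2 : ∀ t ∈ Icc m b, γ t = β t := fun t ht => by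
    rcases ht.1.eq_or_lt with rfl | h
    · simp [hγ, hαβ]
    · simp [hγ, not_le.2 h]
  have hun : Icc a b = Icc a m ∪ Icc m b := (Icc_union_Icc_eq_Icc ham hmb).symm
  have hl : ∀ t ∈ Icc a m, HasDerivWithinAt γ (v t (γ t)) (Icc a m) t := fun t ht => by
    rw [h1 t ht]
    exact (hα t ht).congr_of_mem h1 ht
  have hr : ∀ t ∈ Icc m b, HasDerivWithinAt γ (v t (γ t)) (Icc m b) t := fun t ht => by
    rw [h2 t ht]
    exact (hβ t ht).congr_of_mem h2 ht
  refine ⟨γ, h1 a (left_mem_Icc.2 ham), fun t ht => ?_⟩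
  rw [hun]
  rcases lt_trichotomy t m with h | rfl | h
  · refine (hl t ⟨ht.1, h.le⟩).union ?_
    refine HasFDerivWithinAt.of_notMem_closure ?_
    simp [h]
  · exact (hl t ⟨ham, le_rfl⟩).union (hr t ⟨le_rfl, hmb⟩)
  · refine HasDerivWithinAt.union ?_ (hr t ⟨h.le, ht.2⟩)
    refine HasFDerivWithinAt.of_notMem_closure ?_
    simp [h]

theorem exists_solution [CompleteSpace E] {v : ℝ → E → E} {K : NNReal} {A : ℝ}
    (hv : Continuous (Function.uncurry v))
    (hK : ∀ t, LipschitzWith K (v t)) (hA : ∀ t, ‖v t 0‖ ≤ A) {a b : ℝ} (hab : a ≤ b) (x : E) :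
    ∃ α : ℝ → E, α a = x ∧ ∀ t ∈ Icc a b, HasDerivWithinAt α (v t (α t)) (Icc a b) t := by
  -- The admissible length of a short interval does not depend on the starting point, so repeated
  -- bisection reaches any length.
  have key : ∀ n : ℕ, ∀ a b : ℝ, a ≤ b → (b - a) * (2 * K) ≤ 2 ^ n → ∀ x : E,
      ∃ α : ℝ → E, α a = x ∧ ∀ t ∈ Icc a b, HasDerivWithinAt α (v t (α t)) (Icc a b) t := by
    intro n
    induction n with
    | zero => exact fun a b hab h x => exists_solution_of_short hv hK hA hab (by simpa using h) x
    | succ n ih =>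
      intro a b hab h x
      have h1 : a ≤ (a + b) / 2 := by linarith
      have h2 : (a + b) / 2 ≤ b := by linarith
      rw [pow_succ] at h
      obtain ⟨α, hα0, hα⟩ := ih a ((a + b) / 2) h1 (by linarith) x
      obtain ⟨β, hβ0, hβ⟩ := ih ((a + b) / 2) b h2 (by linarith) (α ((a + b) / 2))
      obtain ⟨γ, hγ0, hγ⟩ := exists_solution_glue h1 h2 hβ0 hα hβ
      exact ⟨γ, hγ0.trans hα0, hγ⟩
  obtain ⟨n, hn⟩ := pow_unbounded_of_one_lt ((b - a) * (2 * K)) (one_lt_two (α := ℝ))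
  exact key n a b hab hn.le x

theorem exists_isFlow [CompleteSpace E] {v : ℝ → E → E} {K : NNReal} {A : ℝ}
    (hv : Continuous (Function.uncurry v))
    (hK : ∀ t, LipschitzWith K (v t)) (hA : ∀ t, ‖v t 0‖ ≤ A) : ∃ Φ, IsFlow v Φ := by
  have h : ∀ s : ℝ, ∀ x : E, ∃ α : ℝ → E, s ≤ 1 → (α s = x ∧ ∀ t ∈ Icc s 1,
      HasDerivWithinAt α (v t (α t)) (Icc s 1) t) := fun s x => by
    by_cases hs : s ≤ 1
    · obtain ⟨α, hα⟩ := exists_solution hv hK hA hs x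
      exact ⟨α, fun _ => hα⟩
    · exact ⟨0, fun h => absurd h hs⟩
  choose Φ hΦ using h
  exact ⟨Φ, fun s hs x => (hΦ s x hs.2).1, fun s hs x => (hΦ s x hs.2).2⟩

theorem hasDerivWithinAt_Ici_of_Icc {α : ℝ → E} {α' : E} {a b t : ℝ}
    (h : HasDerivWithinAt α α' (Icc a b) t) (ht : t ∈ Ico a b) :
    HasDerivWithinAt α α' (Ici t) t :=
  h.mono_of_mem_nhdsWithin (mem_of_superset (Icc_mem_nhdsGE ht.2) (Icc_subset_Icc_left ht.1))

theorem eqOn_of_solutions {v : ℝ → E → E} {K : NNReal}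
    (hK : ∀ t, LipschitzWith K (v t)) {a b : ℝ} {α β : ℝ → E}
    (hα : ∀ t ∈ Icc a b, HasDerivWithinAt α (v t (α t)) (Icc a b) t)
    (hβ : ∀ t ∈ Icc a b, HasDerivWithinAt β (v t (β t)) (Icc a b) t) (hab : α a = β a) :
    EqOn α β (Icc a b) :=
  ODE_solution_unique hK (fun t ht => (hα t ht).continuousWithinAt)
    (fun t ht => hasDerivWithinAt_Ici_of_Icc (hα t (Ico_subset_Icc_self ht)) ht)
    (fun t ht => (hβ t ht).continuousWithinAt)
    (fun t ht => hasDerivWithinAt_Ici_of_Icc (hβ t (Ico_subset_Icc_self ht)) ht) hab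

namespace IsFlow

variable {v : ℝ → E → E} {Φ : ℝ → E → ℝ → E} {K : NNReal} {A : ℝ}

theorem continuousOn (hΦ : IsFlow v Φ) {s : ℝ} (hs : s ∈ Icc (0 : ℝ) 1) (x : E) :
    ContinuousOn (Φ s x) (Icc s 1) :=
  fun t ht => (hΦ.deriv s hs x t ht).continuousWithinAt

theorem hasDerivWithinAt_Ici (hΦ : IsFlow v Φ) {s t : ℝ} (hs : s ∈ Icc (0 : ℝ) 1) (x : E)
    (ht : t ∈ Ico s 1) : HasDerivWithinAt (Φ s x) (v t (Φ s x t)) (Ici t) t :=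
  hasDerivWithinAt_Ici_of_Icc (hΦ.deriv s hs x t (Ico_subset_Icc_self ht)) ht

theorem norm_sub_le (hΦ : IsFlow v Φ) (hK : ∀ t, LipschitzWith K (v t)) {s t : ℝ}
    (hs : s ∈ Icc (0 : ℝ) 1) (ht : t ∈ Icc s 1) (x y : E) :
    ‖Φ s x t - Φ s y t‖ ≤ Real.exp K * ‖x - y‖ := by
  have h := dist_le_of_trajectories_ODE hK (hΦ.continuousOn hs x)
    (fun t ht => hΦ.hasDerivWithinAt_Ici hs x ht) (hΦ.continuousOn hs y)
    (fun t ht => hΦ.hasDerivWithinAt_Ici hs y ht) (le_refl (dist (Φ s x s) (Φ s y s))) t ht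
  rw [hΦ.init s hs, hΦ.init s hs, dist_eq_norm, dist_eq_norm] at h
  refine h.trans ?_
  rw [mul_comm]
  have : (K : ℝ) * (t - s) ≤ K := mul_le_of_le_one_right K.2 (by linarith [hs.1, ht.2])
  gcongr

theorem comp (hΦ : IsFlow v Φ) (hK : ∀ t, LipschitzWith K (v t)) {s t r : ℝ}
    (hs : s ∈ Icc (0 : ℝ) 1) (ht : t ∈ Icc s 1) (hr : r ∈ Icc t 1) (x : E) :
    Φ t (Φ s x t) r = Φ s x r := by
  have ht' : t ∈ Icc (0 : ℝ) 1 := ⟨hs.1.trans ht.1, ht.2⟩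
  refine eqOn_of_solutions hK (hΦ.deriv t ht' _) (fun q hq => ?_) (hΦ.init t ht' _) hr
  exact (hΦ.deriv s hs x q ⟨ht.1.trans hq.1, hq.2⟩).mono (Icc_subset_Icc_left ht.1)

/-- The displacement `x ↦ Φ s x t - x` is Lipschitz with a constant proportional to `t - s`. -/
theorem norm_sub_sub_sub_le (hΦ : IsFlow v Φ) (hK : ∀ t, LipschitzWith K (v t)) {s t : ℝ}
    (hs : s ∈ Icc (0 : ℝ) 1) (ht : t ∈ Icc s 1) (x y : E) :
    ‖(Φ s x t - Φ s y t) - (x - y)‖ ≤ K * (Real.exp K * ‖x - y‖) * (t - s) := by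
  have h := norm_image_sub_le_of_norm_deriv_right_le_segment (a := s) (b := 1)
    (f := fun t => Φ s x t - Φ s y t) (C := K * (Real.exp K * ‖x - y‖))
    ((hΦ.continuousOn hs x).sub (hΦ.continuousOn hs y))
    (fun t ht => (hΦ.hasDerivWithinAt_Ici hs x ht).sub (hΦ.hasDerivWithinAt_Ici hs y ht))
    (fun t ht => by
      have h1 := (hK t).dist_le_mul (Φ s x t) (Φ s y t)
      rw [dist_eq_norm, dist_eq_norm] at h1
      refine h1.trans ?_
      gcongr
      exact hΦ.norm_sub_le hK hs (Ico_subset_Icc_self ht) x y) t ht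
  simpa only [hΦ.init s hs] using h

/-- Grönwall first bounds the displacement by a multiple of 1 + ‖x‖, without the factor t - s. This
bounds the speed along the trajectory, and the mean value inequality then supplies that factor. -/
theorem exists_norm_sub_le (hΦ : IsFlow v Φ) (hK : ∀ t, LipschitzWith K (v t))
    (hA : ∀ t, ‖v t 0‖ ≤ A) :
    ∃ c : ℝ, 0 ≤ c ∧ ∀ s ∈ Icc (0 : ℝ) 1, ∀ t ∈ Icc s 1, ∀ x,
      ‖Φ s x t - x‖ ≤ c * (1 + ‖x‖) * (t - s) := by
  have hA0 : 0 ≤ A := (norm_nonneg _).trans (hA 0)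
  have hg : 0 ≤ gronwallBound 0 K (A + K) 1 := by
    have := gronwallBound_mono (le_refl (0 : ℝ)) (add_nonneg hA0 K.2) K.2 (zero_le_one (α := ℝ))
    rwa [gronwallBound_x0] at this
  set c₀ := gronwallBound 0 K (A + K) 1
  have hK0 : (0 : ℝ) ≤ K := K.2
  refine ⟨(A + K) + K * c₀, by positivity, fun s hs t ht x => ?_⟩
  have hlin : ∀ (r : ℝ) (ε : ℝ), gronwallBound 0 K ((A + K) * ε) r
      = gronwallBound 0 K (A + K) r * ε := fun r ε => by
    unfold gronwallBound
    split_ifs <;> ring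
  have hder : ∀ t ∈ Ico s 1, HasDerivWithinAt (fun t => Φ s x t - x) (v t (Φ s x t)) (Ici t) t :=
    fun t ht => (hΦ.hasDerivWithinAt_Ici hs x ht).sub_const x
  have hcont : ContinuousOn (fun t => Φ s x t - x) (Icc s 1) :=
    (hΦ.continuousOn hs x).sub continuousOn_const
  have hbd : ∀ t, ‖v t (Φ s x t)‖ ≤ K * ‖Φ s x t - x‖ + (A + K) * (1 + ‖x‖) := fun t => by
    have h1 := norm_le_of_lipschitzWith hK hA t (Φ s x t)
    have h2 : ‖Φ s x t‖ ≤ ‖Φ s x t - x‖ + ‖x‖ := by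
      linarith [norm_sub_norm_le (Φ s x t) x]
    nlinarith [norm_nonneg x, mul_le_mul_of_nonneg_left h2 hK0]
  have h1 : ∀ t ∈ Icc s 1, ‖Φ s x t - x‖ ≤ c₀ * (1 + ‖x‖) := fun t ht => by
    have h := norm_le_gronwallBound_of_norm_deriv_right_le (δ := 0) hcont hder
      (by simp [hΦ.init s hs]) (fun t _ => hbd t) t ht
    refine h.trans ?_
    rw [← hlin]
    refine gronwallBound_mono le_rfl (by positivity) hK0 ?_
    linarith [hs.1, ht.2]
  have h2 := norm_image_sub_le_of_norm_deriv_right_le_segment hcont hder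
    (C := ((A + K) + K * c₀) * (1 + ‖x‖)) (fun t ht => by
      have := mul_le_mul_of_nonneg_left (h1 t (Ico_subset_Icc_self ht)) hK0
      nlinarith [hbd t]) t ht
  simpa [hΦ.init s hs] using h2

end IsFlow

end Flow

end Follmer


namespace Follmer

/-! ### Mollification of Lipschitz functions by bump functions -/

section Mollifier

variable {E F : Type*} [NormedAddCommGroup E] [InnerProductSpace ℝ E] [FiniteDimensional ℝ E]
  [MeasurableSpace E] [BorelSpace E] [NormedAddCommGroup F] [NormedSpace ℝ F]

/-- The average `∫ φ z • f (x - z) dz` of `f` against a normalised bump function. -/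
noncomputable def mollify (φ : ContDiffBump (0 : E)) (f : E → F) (x : E) : F :=
  ∫ z, φ.normed volume z • f (x - z)

/-- The derivative of `mollify φ f`. -/
noncomputable def mollifyDeriv (φ : ContDiffBump (0 : E)) (f : E → F) (x : E) : E →L[ℝ] F :=
  ∫ z, (fderiv ℝ (φ.normed volume) z).smulRight (f (x - z))

theorem integrable_bump_smul (φ : ContDiffBump (0 : E)) {f : E → F} (hf : Continuous f) :
    Integrable fun z => φ.normed volume z • f z :=
  (φ.continuous_normed.smul hf).integrable_of_hasCompactSupport
    φ.hasCompactSupport_normed.smul_right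

theorem continuous_fderiv_bump (φ : ContDiffBump (0 : E)) :
    Continuous (fderiv ℝ (φ.normed volume)) :=
  (φ.contDiff_normed (n := 1)).continuous_fderiv one_ne_zero

theorem integrable_fderiv_bump (φ : ContDiffBump (0 : E)) {f : E → F} (hf : Continuous f) :
    Integrable fun z => (fderiv ℝ (φ.normed volume) z).smulRight (f z) := by
  refine Continuous.integrable_of_hasCompactSupport ?_ ?_
  · exact (ContinuousLinearMap.smulRightL ℝ E F).continuous₂.comp
      ((continuous_fderiv_bump φ).prodMk hf)
  · refine ((φ.hasCompactSupport_normed (μ := volume)).fderiv (𝕜 := ℝ)).mono ?_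
    intro z hz
    contrapose! hz
    simp only [Function.mem_support, ne_eq, not_not] at hz ⊢
    rw [hz]
    ext
    simp

/-- The average is a convolution, so the derivative falls on the bump and `f` need only be
continuous. -/
theorem hasFDerivAt_mollify (φ : ContDiffBump (0 : E)) {f : E → F} (hf : Continuous f) (x : E) :
    HasFDerivAt (mollify φ f) (mollifyDeriv φ f x) x := by
  have h := φ.hasCompactSupport_normed.hasFDerivAt_convolution_left
    (ContinuousLinearMap.lsmul ℝ ℝ) (φ.contDiff_normed (n := 1) (μ := volume))
    (hf.locallyIntegrable (μ := volume)) x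
  exact h

/-- The bump is a probability density supported in the ball of radius `φ.rOut`, so a pointwise bound
there survives averaging. Two functions and two base points are allowed, which covers comparison
with a constant as well as comparison across times. -/
theorem norm_mollify_sub_le (φ : ContDiffBump (0 : E)) {f g : E → F} (hf : Continuous f)
    (hg : Continuous g) {x y : E} {c : ℝ}
    (h : ∀ z, ‖z‖ ≤ φ.rOut → ‖f (x - z) - g (y - z)‖ ≤ c) :
    ‖mollify φ f x - mollify φ g y‖ ≤ c := by
  unfold mollify
  rw [← integral_sub (integrable_bump_smul φ (by fun_prop : Continuous fun z => f (x - z)))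
    (integrable_bump_smul φ (by fun_prop : Continuous fun z => g (y - z)))]
  have hc : ∫ z, φ.normed volume z * c = c := by
    rw [integral_mul_const, φ.integral_normed, one_mul]
  rw [← hc]
  refine norm_integral_le_of_norm_le (φ.integrable_normed.mul_const c) ?_
  refine Eventually.of_forall fun z => ?_
  rw [← smul_sub, norm_smul, Real.norm_of_nonneg (φ.nonneg_normed z)]
  by_cases hz : ‖z‖ ≤ φ.rOut
  · exact mul_le_mul_of_nonneg_left (h z hz) (φ.nonneg_normed z)
  · have : φ.normed volume z = 0 := by
      rw [ContDiffBump.normed, φ.zero_of_le_dist (by simpa using (not_le.1 hz).le), zero_div]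
    simp [this]

/-- Average size of the derivative of a normalised bump function. -/
noncomputable def bumpVariation (φ : ContDiffBump (0 : E)) : ℝ :=
  ∫ z, ‖fderiv ℝ (φ.normed volume) z‖

theorem bumpVariation_nonneg (φ : ContDiffBump (0 : E)) : 0 ≤ bumpVariation φ :=
  integral_nonneg fun _ => norm_nonneg _

variable {φ : ContDiffBump (0 : E)} {f : E → F} {L : ℝ}

theorem norm_mollify_sub_self_le [CompleteSpace F] (hf : Continuous f) (hL : 0 ≤ L)
    (h : ∀ x y, ‖f x - f y‖ ≤ L * ‖x - y‖) (x : E) :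
    ‖mollify φ f x - f x‖ ≤ L * φ.rOut := by
  have hconst : mollify φ (fun _ => f x) x = f x := by
    unfold mollify
    rw [integral_smul_const, φ.integral_normed, one_smul]
  rw [← hconst]
  refine (norm_mollify_sub_le φ hf continuous_const fun z hz => (h _ _).trans ?_)
  simpa using mul_le_mul_of_nonneg_left hz hL

theorem norm_mollifyDeriv_le (hf : Continuous f) (hL : 0 ≤ L)
    (h : ∀ x y, ‖f x - f y‖ ≤ L * ‖x - y‖) (x : E) : ‖mollifyDeriv φ f x‖ ≤ L := by
  refine (hasFDerivAt_mollify φ hf x).le_of_lip' hL (Eventually.of_forall fun y => ?_)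
  refine norm_mollify_sub_le φ hf hf fun z _ => ?_
  simpa using h (y - z) (x - z)

theorem norm_mollifyDeriv_sub_le (hf : Continuous f)
    (h : ∀ x y, ‖f x - f y‖ ≤ L * ‖x - y‖) (x y : E) :
    ‖mollifyDeriv φ f x - mollifyDeriv φ f y‖ ≤ bumpVariation φ * (L * ‖x - y‖) := by
  unfold mollifyDeriv bumpVariation
  rw [← integral_sub (integrable_fderiv_bump φ (by fun_prop : Continuous fun z => f (x - z)))
    (integrable_fderiv_bump φ (by fun_prop : Continuous fun z => f (y - z))),
    ← integral_mul_const]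
  refine norm_integral_le_of_norm_le (Integrable.mul_const ?_ _) (Eventually.of_forall fun z => ?_)
  · exact (continuous_fderiv_bump φ).norm.integrable_of_hasCompactSupport
      (φ.hasCompactSupport_normed.fderiv (𝕜 := ℝ)).norm
  · have h1 : (fderiv ℝ (φ.normed volume) z).smulRight (f (x - z))
        - (fderiv ℝ (φ.normed volume) z).smulRight (f (y - z))
        = (fderiv ℝ (φ.normed volume) z).smulRight (f (x - z) - f (y - z)) := by
      ext
      simp [smul_sub]
    rw [h1, ContinuousLinearMap.norm_smulRight_apply]
    gcongr
    simpa using h (x - z) (y - z)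

theorem continuous_mollifyDeriv (hf : Continuous f)
    (h : ∀ x y, ‖f x - f y‖ ≤ L * ‖x - y‖) : Continuous (mollifyDeriv φ f) := by
  have h1 : LipschitzWith (Real.toNNReal (bumpVariation φ * L)) (mollifyDeriv φ f) := by
    refine LipschitzWith.of_dist_le' fun x y => ?_
    rw [dist_eq_norm, dist_eq_norm]
    simpa [mul_assoc] using norm_mollifyDeriv_sub_le hf h x y
  exact h1.continuous

/-- Differentiating the bump makes the derivative of the mollified function Lipschitz, and the mean
value inequality on the segment gives a quadratic error. The constant depends on the bump, which is
harmless because the bump stays fixed while the time step shrinks. -/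
theorem norm_mollify_taylor_le (hf : Continuous f) (hL : 0 ≤ L)
    (h : ∀ x y, ‖f x - f y‖ ≤ L * ‖x - y‖) (x y : E) :
    ‖mollify φ f y - mollify φ f x - mollifyDeriv φ f x (y - x)‖
      ≤ bumpVariation φ * L * ‖y - x‖ ^ 2 := by
  have h1 := (convex_segment x y).norm_image_sub_le_of_norm_hasFDerivWithin_le'
    (f := mollify φ f) (f' := mollifyDeriv φ f) (φ := mollifyDeriv φ f x)
    (C := bumpVariation φ * (L * ‖y - x‖))
    (fun z _ => (hasFDerivAt_mollify φ hf z).hasFDerivWithinAt)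
    (fun z hz => by
      refine (norm_mollifyDeriv_sub_le hf h z x).trans ?_
      have := bumpVariation_nonneg φ
      gcongr
      obtain ⟨θ, hθ, rfl⟩ := (segment_eq_image' ℝ x y ▸ hz)
      rw [add_sub_cancel_left, norm_smul, Real.norm_of_nonneg hθ.1]
      exact mul_le_of_le_one_left (norm_nonneg _) hθ.2)
    (left_mem_segment ℝ x y) (right_mem_segment ℝ x y)
  refine h1.trans (le_of_eq ?_)
  ring

end Mollifier

/-! ### First-order remainders of random curves -/

section Remainder

variable {Ω E : Type*} [NormedAddCommGroup E] [NormedSpace ℝ E]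

/-- The first-order remainder of a curve, plus its squared increment. -/
noncomputable def remainder (Z : ℝ → Ω → E) (Z' : Ω → E) (t s : ℝ) (ω : Ω) : ℝ :=
  (s - t)⁻¹ * (‖Z s ω - Z t ω - (s - t) • Z' ω‖ + ‖Z s ω - Z t ω‖ ^ 2)

variable {Z : ℝ → Ω → E} {Z' : Ω → E} {t r : ℝ} {B : Ω → ℝ}

theorem norm_deriv_le_of_increment (htr : t < r)
    (hder : ∀ ω, HasDerivWithinAt (fun s => Z s ω) (Z' ω) (Ici t) t)
    (hB : ∀ ω, ∀ s ∈ Icc t r, ‖Z s ω - Z t ω‖ ≤ (s - t) * B ω) (ω : Ω) : ‖Z' ω‖ ≤ B ω := by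
  have h1 := (hasDerivWithinAt_iff_tendsto_slope.1 (hder ω)).norm
  rw [Ici_sdiff_left] at h1
  refine le_of_tendsto h1 ?_
  filter_upwards [Ioc_mem_nhdsGT htr] with s hs
  rw [slope_def_module, norm_smul, norm_inv, Real.norm_of_nonneg (sub_pos.2 hs.1).le,
    inv_mul_le_iff₀ (sub_pos.2 hs.1)]
  exact hB ω s (Ioc_subset_Icc_self hs)

theorem remainder_le (htr : t < r)
    (hder : ∀ ω, HasDerivWithinAt (fun s => Z s ω) (Z' ω) (Ici t) t)
    (hB : ∀ ω, ∀ s ∈ Icc t r, ‖Z s ω - Z t ω‖ ≤ (s - t) * B ω) {s : ℝ} (hs : s ∈ Ioc t r) (ω : Ω) :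
    ‖remainder Z Z' t s ω‖ ≤ 2 * B ω + (r - t) * B ω ^ 2 := by
  have hst := sub_pos.2 hs.1
  have h0 := norm_deriv_le_of_increment htr hder hB ω
  have h1 := hB ω s (Ioc_subset_Icc_self hs)
  have hB0 : 0 ≤ B ω := (norm_nonneg _).trans h0
  have h2 : ‖Z s ω - Z t ω - (s - t) • Z' ω‖ ≤ (s - t) * B ω + (s - t) * B ω := by
    refine (norm_sub_le _ _).trans (add_le_add h1 ?_)
    rw [norm_smul, Real.norm_of_nonneg hst.le]
    gcongr
  have h3 : ‖Z s ω - Z t ω‖ ^ 2 ≤ ((s - t) * B ω) ^ 2 := by gcongr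
  unfold remainder
  rw [Real.norm_of_nonneg (by positivity), inv_mul_le_iff₀ hst]
  have h4 : (s - t) * B ω ^ 2 ≤ (r - t) * B ω ^ 2 := by
    have := hs.2
    gcongr
  nlinarith

variable [MeasurableSpace Ω] {π : Measure Ω}

theorem aestronglyMeasurable_remainder (hZ : ∀ s ∈ Icc t r, AEStronglyMeasurable (Z s) π)
    (hZ' : AEStronglyMeasurable Z' π) {s : ℝ} (hs : s ∈ Ioc t r) :
    AEStronglyMeasurable (remainder Z Z' t s) π := by
  have h1 := hZ s (Ioc_subset_Icc_self hs)
  have h2 := hZ t ⟨le_rfl, hs.1.le.trans hs.2⟩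
  unfold remainder
  fun_prop

theorem integrable_remainder [IsProbabilityMeasure π] (hZ : ∀ s ∈ Icc t r, AEStronglyMeasurable (Z s) π)
    (hZ' : AEStronglyMeasurable Z' π)
    (hder : ∀ ω, HasDerivWithinAt (fun s => Z s ω) (Z' ω) (Ici t) t)
    (hB : ∀ ω, ∀ s ∈ Icc t r, ‖Z s ω - Z t ω‖ ≤ (s - t) * B ω) (hB2 : MemLp B 2 π)
    {s : ℝ} (hs : s ∈ Ioc t r) : Integrable (remainder Z Z' t s) π :=
  (((hB2.integrable one_le_two).const_mul 2).add (hB2.integrable_sq.const_mul (r - t))).mono'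
    (aestronglyMeasurable_remainder hZ hZ' hs)
    (Eventually.of_forall fun ω => remainder_le (hs.1.trans_le hs.2) hder hB hs ω)

/-- Pathwise the remainder equals ‖slope - Z'‖ + (s - t) ‖slope‖², which tends to 0. The Lipschitz
bound `B` on increments dominates it by 2 B + (r - t) B², integrable because `B` is square
integrable. -/
theorem tendsto_integral_remainder [IsProbabilityMeasure π] (htr : t < r)
    (hZ : ∀ s ∈ Icc t r, AEStronglyMeasurable (Z s) π) (hZ' : AEStronglyMeasurable Z' π)
    (hder : ∀ ω, HasDerivWithinAt (fun s => Z s ω) (Z' ω) (Ici t) t)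
    (hB : ∀ ω, ∀ s ∈ Icc t r, ‖Z s ω - Z t ω‖ ≤ (s - t) * B ω) (hB2 : MemLp B 2 π) :
    Tendsto (fun s => ∫ ω, remainder Z Z' t s ω ∂π) (𝓝[>] t) (𝓝 0) := by
  have h0 : ∫ _ω : Ω, (0 : ℝ) ∂π = 0 := integral_zero _ _
  rw [← h0]
  have hmem : Ioc t r ∈ 𝓝[>] t := Ioc_mem_nhdsGT htr
  refine tendsto_integral_filter_of_dominated_convergence
    (fun ω => 2 * B ω + (r - t) * B ω ^ 2) ?_ ?_ ?_ ?_
  · filter_upwards [hmem] with s hs using aestronglyMeasurable_remainder hZ hZ' hs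
  · filter_upwards [hmem] with s hs using Eventually.of_forall fun ω => remainder_le htr hder hB hs ω
  · exact ((hB2.integrable one_le_two).const_mul 2).add (hB2.integrable_sq.const_mul (r - t))
  · refine Eventually.of_forall fun ω => ?_
    have h1 := hasDerivWithinAt_iff_tendsto_slope.1 (hder ω)
    rw [Ici_sdiff_left] at h1
    have h2 : Tendsto (fun s => ‖slope (fun s => Z s ω) t s - Z' ω‖
        + (s - t) * ‖slope (fun s => Z s ω) t s‖ ^ 2) (𝓝[>] t) (𝓝 0) := by
      have h3 : Tendsto (fun s : ℝ => s - t) (𝓝[>] t) (𝓝 0) := by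
        have : Tendsto (fun s : ℝ => s - t) (𝓝 t) (𝓝 (t - t)) := by
          exact (continuous_sub_right t).tendsto t
        rw [sub_self] at this
        exact this.mono_left nhdsWithin_le_nhds
      have h4 := (h1.sub_const (Z' ω)).norm.add (h3.mul (h1.norm.pow 2))
      simpa using h4
    refine h2.congr' ?_
    filter_upwards [self_mem_nhdsWithin] with s hs
    have hst : 0 < s - t := sub_pos.2 hs
    have h5 : Z s ω - Z t ω = (s - t) • slope (fun s => Z s ω) t s := by
      rw [slope_def_module, smul_smul, mul_inv_cancel₀ hst.ne', one_smul]
    unfold remainder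
    rw [h5, ← smul_sub, norm_smul, norm_smul, Real.norm_of_nonneg hst.le]
    field_simp

end Remainder

end Follmer


namespace Follmer

theorem continuous_of_norm_sub_le {E F : Type*} [SeminormedAddCommGroup E]
    [SeminormedAddCommGroup F] {f : E → F} {L : ℝ} (hf : ∀ x y, ‖f x - f y‖ ≤ L * ‖x - y‖) :
    Continuous f :=
  (LipschitzWith.of_dist_le' fun x y => by simpa [dist_eq_norm] using hf x y :
    LipschitzWith (Real.toNNReal L) f).continuous

theorem IsFlow.norm_comp_terminal_sub_le {E F : Type*} [NormedAddCommGroup E] [NormedSpace ℝ E]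
    [SeminormedAddCommGroup F] {v : ℝ → E → E} {Φ : ℝ → E → ℝ → E} {K : NNReal} (hΦ : IsFlow v Φ)
    (hK : ∀ t, LipschitzWith K (v t)) {f : E → F} {L : ℝ} (hL : 0 ≤ L)
    (hf : ∀ x y, ‖f x - f y‖ ≤ L * ‖x - y‖) {t : ℝ} (ht : t ∈ Icc (0 : ℝ) 1) (x y : E) :
    ‖f (Φ t x 1) - f (Φ t y 1)‖ ≤ L * Real.exp K * ‖x - y‖ := by
  refine (hf _ _).trans ?_
  rw [mul_assoc]
  gcongr
  exact hΦ.norm_sub_le hK ht (right_mem_Icc.2 ht.2) x y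

theorem integrable_clm_apply_comp {Ω E F : Type*} [NormedAddCommGroup E] [NormedSpace ℝ E]
    [NormedAddCommGroup F] [NormedSpace ℝ F] [MeasurableSpace Ω] {π : Measure Ω} {L : ℝ} {D : E → E →L[ℝ] F} (hD : Continuous D) (hDb : ∀ x, ‖D x‖ ≤ L)
    {Y Y' : Ω → E} (hY : AEStronglyMeasurable Y π) (hY' : AEStronglyMeasurable Y' π) {b : Ω → ℝ}
    (hb : Integrable b π) (hYb : ∀ ω, ‖Y' ω‖ ≤ b ω) : Integrable (fun ω => D (Y ω) (Y' ω)) π := by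
  have h1 : AEStronglyMeasurable (fun ω => D (Y ω) (Y' ω)) π := by
    have h2 : Continuous fun p : (E →L[ℝ] F) × E => p.1 p.2 := by fun_prop
    exact h2.comp_aestronglyMeasurable ((hD.comp_aestronglyMeasurable hY).prodMk hY')
  refine (hb.const_mul L).mono' h1 (Eventually.of_forall fun ω => ?_)
  refine ((D (Y ω)).le_opNorm _).trans ?_
  exact mul_le_mul (hDb _) (hYb ω) (norm_nonneg _) ((norm_nonneg _).trans (hDb 0))

/-! ### Transport of expectations along a curve with prescribed mean velocity -/

section Transport

variable {Ω E F : Type*} [NormedAddCommGroup E] [InnerProductSpace ℝ E]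
  [NormedAddCommGroup F] [NormedSpace ℝ F]

/-- A random curve with square-integrable increments whose velocity at time `t`, averaged
conditionally on the position, is the vector field `v t`. -/
structure IsDriftedCurve [MeasurableSpace Ω] (π : Measure Ω) (v : ℝ → E → E) (X X' : ℝ → Ω → E)
    (F : Type*) [NormedAddCommGroup F] [NormedSpace ℝ F] : Prop where
  aestronglyMeasurable : ∀ t ∈ Icc (0 : ℝ) 1, AEStronglyMeasurable (X t) π
  aestronglyMeasurable_deriv : ∀ t ∈ Ico (0 : ℝ) 1, AEStronglyMeasurable (X' t) π
  continuousOn : ∀ ω, ContinuousOn (fun t => X t ω) (Icc 0 1)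
  hasDeriv : ∀ t ∈ Ico (0 : ℝ) 1, ∀ ω, HasDerivWithinAt (fun s => X s ω) (X' t ω) (Ici t) t
  increment : ∀ t ∈ Ico (0 : ℝ) 1, ∃ r ∈ Ioc t 1, ∃ B : Ω → ℝ, MemLp B 2 π ∧
    ∀ ω, ∀ s ∈ Icc t r, ‖X s ω - X t ω‖ ≤ (s - t) * B ω
  memLp : ∀ t ∈ Ico (0 : ℝ) 1, MemLp (X t) 2 π
  drift : ∀ t ∈ Ico (0 : ℝ) 1, ∀ ψ : E → E →L[ℝ] F, Continuous ψ → (∃ c, ∀ x, ‖ψ x‖ ≤ c) →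
    ∫ ω, ψ (X t ω) (X' t ω) ∂π = ∫ ω, ψ (X t ω) (v t (X t ω)) ∂π

variable {v : ℝ → E → E} {Φ : ℝ → E → ℝ → E} {K : NNReal} {A : ℝ}

/-- Lipschitz bound for the terminal value of the flow, as a function of the starting time and
point. -/
theorem IsFlow.exists_norm_terminal_sub_le (hΦ : IsFlow v Φ) (hK : ∀ t, LipschitzWith K (v t))
    (hA : ∀ t, ‖v t 0‖ ≤ A) :
    ∃ c : ℝ, 0 ≤ c ∧ ∀ s ∈ Icc (0 : ℝ) 1, ∀ t ∈ Icc (0 : ℝ) 1, ∀ x y,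
      ‖Φ s x 1 - Φ t y 1‖ ≤ Real.exp K * (‖x - y‖ + c * (1 + ‖x‖ + ‖y‖) * |s - t|) := by
  obtain ⟨c, hc0, hc⟩ := hΦ.exists_norm_sub_le hK hA
  have key : ∀ s ∈ Icc (0 : ℝ) 1, ∀ t ∈ Icc s 1, ∀ x y,
      ‖Φ s x 1 - Φ t y 1‖ ≤ Real.exp K * (‖x - y‖ + c * (1 + ‖x‖ + ‖y‖) * |s - t|) := by
    intro s hs t ht x y
    have ht' : t ∈ Icc (0 : ℝ) 1 := ⟨hs.1.trans ht.1, ht.2⟩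
    rw [← hΦ.comp hK hs ht (right_mem_Icc.2 ht.2) x]
    refine (hΦ.norm_sub_le hK ht' (right_mem_Icc.2 ht.2) _ _).trans ?_
    gcongr
    have h1 : ‖Φ s x t - y‖ ≤ ‖Φ s x t - x‖ + ‖x - y‖ := norm_sub_le_norm_sub_add_norm_sub _ _ _
    have h2 := hc s hs t ht x
    rw [abs_sub_comm, abs_of_nonneg (sub_nonneg.2 ht.1)]
    have h3 : c * (1 + ‖x‖) * (t - s) ≤ c * (1 + ‖x‖ + ‖y‖) * (t - s) := by
      have := sub_nonneg.2 ht.1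
      refine mul_le_mul_of_nonneg_right (mul_le_mul_of_nonneg_left ?_ hc0) this
      linarith [norm_nonneg y]
    linarith
  refine ⟨c, hc0, fun s hs t ht x y => ?_⟩
  rcases le_total s t with h | h
  · exact key s hs t ⟨h, ht.2⟩ x y
  · have := key t ht s ⟨h, hs.2⟩ y x
    rw [norm_sub_rev, norm_sub_rev x y, abs_sub_comm s t]
    convert this using 4
    ring

variable [FiniteDimensional ℝ E] [MeasurableSpace E] [BorelSpace E] [MeasurableSpace Ω]
  {π : Measure Ω} [IsProbabilityMeasure π] {X X' : ℝ → Ω → E} {f : E → F} {L M : ℝ}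

/-- The expected value at time `t` of the mollified observable `x ↦ f (Φ t x 1)`. -/
noncomputable def transported (φ : ContDiffBump (0 : E)) (π : Measure Ω) (X : ℝ → Ω → E)
    (Φ : ℝ → E → ℝ → E) (f : E → F) (t : ℝ) : F :=
  ∫ ω, mollify φ (fun x => f (Φ t x 1)) (X t ω) ∂π

/-- Dominated convergence with the constant bound `M`. Pointwise, the terminal value is Lipschitz in
the starting time and point, locally uniformly, hence uniformly over the support of the bump. -/
theorem continuousOn_transported [CompleteSpace F] (hΦ : IsFlow v Φ)
    (hK : ∀ t, LipschitzWith K (v t)) (hA : ∀ t, ‖v t 0‖ ≤ A) (hX : IsDriftedCurve π v X X' F)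
    (hL : 0 ≤ L) (hf : ∀ x y, ‖f x - f y‖ ≤ L * ‖x - y‖) (hM : ∀ x, ‖f x‖ ≤ M)
    (φ : ContDiffBump (0 : E)) : ContinuousOn (transported φ π X Φ f) (Icc 0 1) := by
  obtain ⟨c, hc0, hc⟩ := hΦ.exists_norm_terminal_sub_le hK hA
  have hfc : ∀ t ∈ Icc (0 : ℝ) 1, Continuous fun x => f (Φ t x 1) := fun t ht =>
    continuous_of_norm_sub_le (hΦ.norm_comp_terminal_sub_le hK hL hf ht)
  intro t ht
  refine continuousWithinAt_of_dominated (bound := fun _ => M) ?_ ?_ (integrable_const M) ?_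
  · filter_upwards [self_mem_nhdsWithin] with s hs
    have h1 : Continuous (mollify φ fun x => f (Φ s x 1)) :=
      continuous_iff_continuousAt.2 fun x => (hasFDerivAt_mollify φ (hfc s hs) x).continuousAt
    exact h1.comp_aestronglyMeasurable (hX.aestronglyMeasurable s hs)
  · filter_upwards [self_mem_nhdsWithin] with s hs
    refine Eventually.of_forall fun ω => ?_
    have h0 : mollify φ (fun _ : E => (0 : F)) 0 = 0 := by simp [mollify]
    have := norm_mollify_sub_le φ (hfc s hs) (continuous_const (y := (0 : F))) (x := X s ω) (y := 0)
      (c := M) (fun z _ => by simpa using hM _)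
    simpa [h0] using this
  · refine Eventually.of_forall fun ω => ?_
    have hXc := hX.continuousOn ω t ht
    rw [ContinuousWithinAt, tendsto_iff_norm_sub_tendsto_zero]
    set b : ℝ → ℝ := fun s => L * (Real.exp K * (‖X s ω - X t ω‖
      + c * (1 + (‖X s ω‖ + φ.rOut) + (‖X t ω‖ + φ.rOut)) * |s - t|)) with hb
    have hb0 : Tendsto b (𝓝[Icc 0 1] t) (𝓝 0) := by
      have hid : ContinuousWithinAt (fun s : ℝ => |s - t|) (Icc 0 1) t := by fun_prop
      have hcont : ContinuousWithinAt b (Icc 0 1) t := by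
        refine continuousWithinAt_const.mul (continuousWithinAt_const.mul ?_)
        refine ((hXc.sub continuousWithinAt_const).norm).add ?_
        exact (continuousWithinAt_const.mul ((continuousWithinAt_const.add
          (hXc.norm.add continuousWithinAt_const)).add continuousWithinAt_const)).mul hid
      have : b t = 0 := by simp [hb]
      have hlim : Tendsto b (𝓝[Icc 0 1] t) (𝓝 (b t)) := hcont
      rwa [this] at hlim
    refine squeeze_zero' (Eventually.of_forall fun _ => norm_nonneg _) ?_ hb0
    filter_upwards [self_mem_nhdsWithin] with s hs
    refine norm_mollify_sub_le φ (hfc s hs) (hfc t ht) fun z hz => ?_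
    refine (hf _ _).trans ?_
    rw [hb]
    refine mul_le_mul_of_nonneg_left ((hc s hs t ht _ _).trans ?_) hL
    rw [sub_sub_sub_cancel_right]
    have h1 : ‖X s ω - z‖ ≤ ‖X s ω‖ + φ.rOut := (norm_sub_le _ _).trans (by gcongr)
    have h2 : ‖X t ω - z‖ ≤ ‖X t ω‖ + φ.rOut := (norm_sub_le _ _).trans (by gcongr)
    gcongr

/-- Mollification commutes with the flow up to an error that is small in both the length of the
time interval and the mollification radius. -/
theorem norm_mollify_terminal_sub_le (hΦ : IsFlow v Φ)
    (hK : ∀ t, LipschitzWith K (v t))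
    (hL : 0 ≤ L) (hf : ∀ x y, ‖f x - f y‖ ≤ L * ‖x - y‖)
    (φ : ContDiffBump (0 : E)) {t s : ℝ} (ht : t ∈ Icc (0 : ℝ) 1) (hs : s ∈ Icc t 1) (x : E) :
    ‖mollify φ (fun x => f (Φ s x 1)) (Φ t x s) - mollify φ (fun x => f (Φ t x 1)) x‖
      ≤ L * Real.exp K * (K * (Real.exp K * φ.rOut) * (s - t)) := by
  have hs' : s ∈ Icc (0 : ℝ) 1 := ⟨ht.1.trans hs.1, hs.2⟩
  refine norm_mollify_sub_le φ
    (continuous_of_norm_sub_le (hΦ.norm_comp_terminal_sub_le hK hL hf hs'))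
    (continuous_of_norm_sub_le (hΦ.norm_comp_terminal_sub_le hK hL hf ht)) fun z hz => ?_
  -- Both terms become the time-`s` observable, evaluated at Φ(t, x, s) - z and at Φ(t, x - z, s).
  -- These points differ by the increment of the displacement map between x and x - z, which is
  -- O(‖z‖ (s - t)).
  rw [← hΦ.comp hK ht hs (right_mem_Icc.2 hs.2) (x - z)]
  refine (hΦ.norm_comp_terminal_sub_le hK hL hf hs' _ _).trans ?_
  gcongr
  have h1 := hΦ.norm_sub_sub_sub_le hK ht hs x (x - z)
  rw [sub_sub_cancel] at h1
  have h2 : Φ t x s - z - Φ t (x - z) s = Φ t x s - Φ t (x - z) s - z := by abel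
  rw [h2]
  refine h1.trans ?_
  have := sub_nonneg.2 hs.1
  gcongr

/-- Two curves leave `x` at time `t`: one reaches `y` with velocity `y'`, the other is the flow with
velocity `z'`. Both are expanded to first order with the same mollified observable at time `s`.
Along the flow the observable is almost conserved, so the increment along the first curve is (s - t)
D(y' - z') up to remainders. -/
theorem norm_mollify_increment_le (hΦ : IsFlow v Φ)
    (hK : ∀ t, LipschitzWith K (v t))
    (hL : 0 ≤ L) (hf : ∀ x y, ‖f x - f y‖ ≤ L * ‖x - y‖)
    (φ : ContDiffBump (0 : E)) {t s : ℝ} (ht : t ∈ Icc (0 : ℝ) 1) (hs : s ∈ Icc t 1)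
    (x y y' z' : E) :
    ‖mollify φ (fun x => f (Φ s x 1)) y - mollify φ (fun x => f (Φ t x 1)) x
        - (s - t) • (mollifyDeriv φ (fun x => f (Φ s x 1)) x y'
          - mollifyDeriv φ (fun x => f (Φ s x 1)) x z')‖
      ≤ L * Real.exp K * (1 + bumpVariation φ) * ((‖y - x - (s - t) • y'‖ + ‖y - x‖ ^ 2)
          + (‖Φ t x s - x - (s - t) • z'‖ + ‖Φ t x s - x‖ ^ 2))
        + L * Real.exp K * (K * (Real.exp K * φ.rOut) * (s - t)) := by
  have hs' : s ∈ Icc (0 : ℝ) 1 := ⟨ht.1.trans hs.1, hs.2⟩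
  have hlip := hΦ.norm_comp_terminal_sub_le hK hL hf hs'
  have hcomm := norm_mollify_terminal_sub_le hΦ hK hL hf φ ht hs x
  have hL'0 : 0 ≤ L * Real.exp K := by positivity
  generalize L * Real.exp K = L' at *
  have hcont := continuous_of_norm_sub_le hlip
  have hb := norm_mollifyDeriv_le (φ := φ) hcont hL'0 hlip x
  have htay := norm_mollify_taylor_le (φ := φ) hcont hL'0 hlip x
  generalize mollifyDeriv φ (fun x => f (Φ s x 1)) x = D at *
  generalize mollify φ (fun x => f (Φ s x 1)) = g at *
  generalize mollify φ (fun x => f (Φ t x 1)) = g' at *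
  have hH0 := bumpVariation_nonneg φ
  generalize bumpVariation φ = H at *
  have htaylor : ∀ y y' : E, ‖g y - g x - (s - t) • D y'‖
      ≤ L' * (1 + H) * (‖y - x - (s - t) • y'‖ + ‖y - x‖ ^ 2) := fun y y' => by
    have h1 : g y - g x - (s - t) • D y' = (g y - g x - D (y - x)) + D (y - x - (s - t) • y') := by
      simp only [map_sub, map_smul]
      abel
    have h2 : ‖D (y - x - (s - t) • y')‖ ≤ L' * ‖y - x - (s - t) • y'‖ :=
      (D.le_opNorm _).trans (by gcongr)
    rw [h1]
    refine (norm_add_le _ _).trans ((add_le_add (htay y) h2).trans ?_)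
    have e1 : 0 ≤ L' * ‖y - x‖ ^ 2 := by positivity
    have e2 : 0 ≤ L' * H * ‖y - x - (s - t) • y'‖ := by positivity
    nlinarith
  have hsplit : g y - g' x - (s - t) • (D y' - D z')
      = (g y - g x - (s - t) • D y') - (g (Φ t x s) - g x - (s - t) • D z')
        + (g (Φ t x s) - g' x) := by
    rw [smul_sub]
    abel
  rw [hsplit]
  refine (norm_add_le _ _).trans ((add_le_add ((norm_sub_le _ _).trans
    (add_le_add (htaylor y y') (htaylor (Φ t x s) z'))) hcomm).trans (le_of_eq ?_))
  ring

theorem integrable_mollify_comp {g : E → F} (hg : Continuous g) (hM : ∀ x, ‖g x‖ ≤ M)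
    (φ : ContDiffBump (0 : E)) {Y : Ω → E} (hY : AEStronglyMeasurable Y π) :
    Integrable (fun ω => mollify φ g (Y ω)) π := by
  have h1 : Continuous (mollify φ g) :=
    continuous_iff_continuousAt.2 fun x => (hasFDerivAt_mollify φ hg x).continuousAt
  refine Integrable.of_bound (h1.comp_aestronglyMeasurable hY) M (Eventually.of_forall fun ω => ?_)
  have h0 : mollify φ (fun _ : E => (0 : F)) 0 = 0 := by simp [mollify]
  have := norm_mollify_sub_le φ hg (continuous_const (y := (0 : F))) (x := Y ω)
    (y := 0) (c := M) (fun z _ => by simpa using hM _)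
  simpa [h0] using this

theorem norm_transported_sub_le (hΦ : IsFlow v Φ)
    (hK : ∀ t, LipschitzWith K (v t)) (hX : IsDriftedCurve π v X X' F)
    (hL : 0 ≤ L) (hf : ∀ x y, ‖f x - f y‖ ≤ L * ‖x - y‖) (hM : ∀ x, ‖f x‖ ≤ M)
    (φ : ContDiffBump (0 : E)) {t s : ℝ} (ht : t ∈ Ico (0 : ℝ) 1) (hs : s ∈ Ioc t 1)
    {b b' : Ω → ℝ} (hb : Integrable b π) (hb' : Integrable b' π)
    (hXb : ∀ ω, ‖X' t ω‖ ≤ b ω) (hvb : ∀ ω, ‖v t (X t ω)‖ ≤ b' ω)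
    (hvm : AEStronglyMeasurable (fun ω => v t (X t ω)) π)
    (hRX : Integrable (remainder X (X' t) t s) π)
    (hRZ : Integrable (remainder (fun s ω => Φ t (X t ω) s) (fun ω => v t (X t ω)) t s) π) :
    ‖transported φ π X Φ f s - transported φ π X Φ f t‖
      ≤ (s - t) * (L * Real.exp K * (K * (Real.exp K * φ.rOut))
        + L * Real.exp K * (1 + bumpVariation φ) * (∫ ω, remainder X (X' t) t s ω ∂π
          + ∫ ω, remainder (fun s ω => Φ t (X t ω) s) (fun ω => v t (X t ω)) t s ω ∂π)) := by
  have ht' := Ico_subset_Icc_self ht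
  have hst : 0 < s - t := sub_pos.2 hs.1
  have hs' : s ∈ Icc (0 : ℝ) 1 := ⟨ht.1.trans hs.1.le, hs.2⟩
  have hlip := hΦ.norm_comp_terminal_sub_le hK hL hf hs'
  have hconts := continuous_of_norm_sub_le hlip
  have hcontt := continuous_of_norm_sub_le (hΦ.norm_comp_terminal_sub_le hK hL hf ht')
  have hL'0 : 0 ≤ L * Real.exp K := by positivity
  have hDc : Continuous (mollifyDeriv φ fun x => f (Φ s x 1)) := continuous_mollifyDeriv hconts hlip
  have hDb := norm_mollifyDeriv_le (φ := φ) hconts hL'0 hlip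
  have hXt := hX.aestronglyMeasurable t ht'
  have hi1 := integrable_mollify_comp hconts (fun x => hM _) φ (hX.aestronglyMeasurable s hs')
  have hi2 := integrable_mollify_comp hcontt (fun x => hM _) φ hXt
  have hI1 := integrable_clm_apply_comp hDc hDb hXt (hX.aestronglyMeasurable_deriv t ht) hb hXb
  have hI2 := integrable_clm_apply_comp hDc hDb hXt hvm hb' hvb
  -- The linear term has mean zero because `X'` and `v` have the same conditional mean given the
  -- position. Mollification provides the continuous bounded test field needed here.
  have hdrift : ∫ ω, (s - t) • (mollifyDeriv φ (fun x => f (Φ s x 1)) (X t ω) (X' t ω)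
      - mollifyDeriv φ (fun x => f (Φ s x 1)) (X t ω) (v t (X t ω))) ∂π = 0 := by
    rw [integral_smul, integral_sub hI1 hI2, hX.drift t ht _ hDc ⟨_, hDb⟩, sub_self, smul_zero]
  have heq : transported φ π X Φ f s - transported φ π X Φ f t
      = ∫ ω, (mollify φ (fun x => f (Φ s x 1)) (X s ω) - mollify φ (fun x => f (Φ t x 1)) (X t ω)
        - (s - t) • (mollifyDeriv φ (fun x => f (Φ s x 1)) (X t ω) (X' t ω)
      - mollifyDeriv φ (fun x => f (Φ s x 1)) (X t ω) (v t (X t ω)))) ∂π := by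
    have e1 : Integrable (fun ω => mollify φ (fun x => f (Φ s x 1)) (X s ω)
        - mollify φ (fun x => f (Φ t x 1)) (X t ω)) π := hi1.sub hi2
    have e2 : Integrable (fun ω => (s - t) • (mollifyDeriv φ (fun x => f (Φ s x 1)) (X t ω) (X' t ω)
      - mollifyDeriv φ (fun x => f (Φ s x 1)) (X t ω) (v t (X t ω)))) π := (hI1.sub hI2).smul (s - t)
    rw [integral_sub e1 e2, hdrift, sub_zero, integral_sub hi1 hi2]
    rfl
  have hR : Integrable (fun ω => remainder X (X' t) t s ω
      + remainder (fun s ω => Φ t (X t ω) s) (fun ω => v t (X t ω)) t s ω) π := hRX.add hRZ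
  have hrhs : (s - t) * (L * Real.exp K * (K * (Real.exp K * φ.rOut))
        + L * Real.exp K * (1 + bumpVariation φ) * (∫ ω, remainder X (X' t) t s ω ∂π
          + ∫ ω, remainder (fun s ω => Φ t (X t ω) s) (fun ω => v t (X t ω)) t s ω ∂π))
      = ∫ ω, (s - t) * (L * Real.exp K * (K * (Real.exp K * φ.rOut))
        + L * Real.exp K * (1 + bumpVariation φ) * (remainder X (X' t) t s ω
          + remainder (fun s ω => Φ t (X t ω) s) (fun ω => v t (X t ω)) t s ω)) ∂π := by
    rw [integral_const_mul, integral_add (integrable_const _) (hR.const_mul _), integral_const,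
      integral_const_mul, integral_add hRX hRZ]
    simp
  rw [heq, hrhs]
  refine norm_integral_le_of_norm_le (((integrable_const _).add
    (hR.const_mul _)).const_mul _) (Eventually.of_forall fun ω => ?_)
  refine (norm_mollify_increment_le hΦ hK hL hf φ ht' ⟨hs.1.le, hs.2⟩ _ _ _ _).trans
    (le_of_eq ?_)
  simp only [remainder, hΦ.init t ht']
  field_simp
  ring

theorem exists_norm_transported_sub_le (hΦ : IsFlow v Φ)
    (hv : Continuous (Function.uncurry v))
    (hK : ∀ t, LipschitzWith K (v t)) (hA : ∀ t, ‖v t 0‖ ≤ A) (hX : IsDriftedCurve π v X X' F)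
    (hL : 0 ≤ L) (hf : ∀ x y, ‖f x - f y‖ ≤ L * ‖x - y‖) (hM : ∀ x, ‖f x‖ ≤ M)
    (φ : ContDiffBump (0 : E)) {t : ℝ} (ht : t ∈ Ico (0 : ℝ) 1) :
    ∃ ρ : ℝ → ℝ, Tendsto ρ (𝓝[>] t) (𝓝 0) ∧ ∀ᶠ s in 𝓝[>] t,
      ‖transported φ π X Φ f s - transported φ π X Φ f t‖
        ≤ (s - t) * (L * Real.exp K * (K * (Real.exp K * φ.rOut)) + ρ s) := by
  have ht' := Ico_subset_Icc_self ht
  obtain ⟨r, hr, B, hB2, hB⟩ := hX.increment t ht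
  obtain ⟨c, hc0, hc⟩ := hΦ.exists_norm_sub_le hK hA
  have hXm : ∀ s ∈ Icc t r, AEStronglyMeasurable (X s) π := fun s hs =>
    hX.aestronglyMeasurable s ⟨ht.1.trans hs.1, hs.2.trans hr.2⟩
  have hX'm := hX.aestronglyMeasurable_deriv t ht
  have hXt := hX.aestronglyMeasurable t ht'
  have hZm : ∀ s ∈ Icc t r, AEStronglyMeasurable (fun ω => Φ t (X t ω) s) π := fun s hs => by
    have h1 : Continuous fun x => Φ t x s :=
      continuous_of_norm_sub_le (hΦ.norm_sub_le hK ht' ⟨hs.1, hs.2.trans hr.2⟩)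
    exact h1.comp_aestronglyMeasurable hXt
  have hvm : AEStronglyMeasurable (fun ω => v t (X t ω)) π :=
    (hv.comp (Continuous.prodMk_right t)).comp_aestronglyMeasurable hXt
  have hZd : ∀ ω, HasDerivWithinAt (fun s => Φ t (X t ω) s) (v t (X t ω)) (Ici t) t := fun ω => by
    have := hΦ.hasDerivWithinAt_Ici ht' (X t ω) (left_mem_Ico.2 ht.2)
    rwa [hΦ.init t ht'] at this
  have hZB : ∀ ω, ∀ s ∈ Icc t r,
      ‖Φ t (X t ω) s - Φ t (X t ω) t‖ ≤ (s - t) * (c * (1 + ‖X t ω‖)) := fun ω s hs => by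
    rw [hΦ.init t ht', mul_comm]
    exact hc t ht' s ⟨hs.1, hs.2.trans hr.2⟩ _
  have hZB1 : MemLp (fun ω => 1 + ‖X t ω‖) 2 π :=
    (memLp_const (1 : ℝ)).add (hX.memLp t ht).norm
  have hZB2 : MemLp (fun ω => c * (1 + ‖X t ω‖)) 2 π := hZB1.const_mul c
  have hXd := hX.hasDeriv t ht
  refine ⟨fun s => L * Real.exp K * (1 + bumpVariation φ) * (∫ ω, remainder X (X' t) t s ω ∂π
    + ∫ ω, remainder (fun s ω => Φ t (X t ω) s) (fun ω => v t (X t ω)) t s ω ∂π), ?_, ?_⟩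
  · have := ((tendsto_integral_remainder hr.1 hXm hX'm hXd hB hB2).add
      (tendsto_integral_remainder hr.1 hZm hvm hZd hZB hZB2)).const_mul
        (L * Real.exp K * (1 + bumpVariation φ))
    simpa using this
  · filter_upwards [Ioc_mem_nhdsGT hr.1] with s hs
    exact norm_transported_sub_le hΦ hK hX hL hf hM φ ht ⟨hs.1, hs.2.trans hr.2⟩
      (hB2.integrable one_le_two) (hZB2.integrable one_le_two)
      (norm_deriv_le_of_increment hr.1 hXd hB) (norm_deriv_le_of_increment hr.1 hZd hZB) hvm
      (integrable_remainder hXm hX'm hXd hB hB2 hs) (integrable_remainder hZm hvm hZd hZB hZB2 hs)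

/-- The terminal value of the curve has the law of the flow started from the initial value,
tested against bounded Lipschitz functions. -/
theorem integral_terminal_eq [CompleteSpace F] (hΦ : IsFlow v Φ)
    (hv : Continuous (Function.uncurry v))
    (hK : ∀ t, LipschitzWith K (v t)) (hA : ∀ t, ‖v t 0‖ ≤ A) (hX : IsDriftedCurve π v X X' F)
    (hL : 0 ≤ L) (hf : ∀ x y, ‖f x - f y‖ ≤ L * ‖x - y‖) (hM : ∀ x, ‖f x‖ ≤ M) :
    ∫ ω, f (X 1 ω) ∂π = ∫ ω, f (Φ 0 (X 0 ω) 1) ∂π := by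
  have h0 : (0 : ℝ) ∈ Icc (0 : ℝ) 1 := left_mem_Icc.2 zero_le_one
  have h1 : (1 : ℝ) ∈ Icc (0 : ℝ) 1 := right_mem_Icc.2 zero_le_one
  set L' := L * Real.exp K with hL'
  have hL'0 : 0 ≤ L' := by positivity
  have hlip : ∀ q ∈ Icc (0 : ℝ) 1, ∀ x y, ‖f (Φ q x 1) - f (Φ q y 1)‖ ≤ L' * ‖x - y‖ :=
    fun q hq => hΦ.norm_comp_terminal_sub_le hK hL hf hq
  have hcont : ∀ q ∈ Icc (0 : ℝ) 1, Continuous fun x => f (Φ q x 1) :=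
    fun q hq => continuous_of_norm_sub_le (hlip q hq)
  -- A continuous curve whose right difference quotients have norm at most C + o(1) at every time
  -- moves by at most C in unit time. The slack `η` provides the strict inequality of slopes
  -- required by the comparison principle.
  have hevol : ∀ φ : ContDiffBump (0 : E), ‖transported φ π X Φ f 1 - transported φ π X Φ f 0‖
      ≤ L' * (K * (Real.exp K * φ.rOut)) := fun φ => by
    set C := L' * (K * (Real.exp K * φ.rOut)) with hC
    refine le_of_forall_pos_le_add fun η hη => ?_
    have := image_norm_le_of_liminf_right_slope_norm_lt_deriv_boundary (a := 0) (b := 1)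
      (f := fun t => transported φ π X Φ f t - transported φ π X Φ f 0) (f' := fun _ => C)
      (B := fun t => (C + η) * t) (B' := fun _ => C + η)
      ((continuousOn_transported hΦ hK hA hX hL hf hM φ).sub continuousOn_const)
      (fun t ht q hq => ?_) (by simp) (by fun_prop)
      (fun t _ => by simpa using ((hasDerivAt_id t).const_mul (C + η)).hasDerivWithinAt)
      (fun t _ _ => by linarith) h1
    · simpa using this
    · obtain ⟨ρ, hρ0, hρ⟩ := exists_norm_transported_sub_le hΦ hv hK hA hX hL hf hM φ ht
      have h2 : Tendsto (fun s => C + ρ s) (𝓝[>] t) (𝓝 C) := by simpa using hρ0.const_add C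
      refine Eventually.frequently ?_
      filter_upwards [hρ, h2.eventually_lt_const hq, self_mem_nhdsWithin] with s hs1 hs2 hs3
      have hst : 0 < s - t := sub_pos.2 hs3
      refine lt_of_le_of_lt ?_ hs2
      rw [slope_def_module, smul_eq_mul, inv_mul_le_iff₀ hst]
      refine le_trans ?_ hs1
      refine (norm_sub_norm_le _ _).trans (le_of_eq ?_)
      rw [sub_sub_sub_cancel_right]
  have hmoll : ∀ φ : ContDiffBump (0 : E), ∀ q ∈ Icc (0 : ℝ) 1,
      ‖transported φ π X Φ f q - ∫ ω, f (Φ q (X q ω) 1) ∂π‖ ≤ L' * φ.rOut := fun φ q hq => by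
    have hm1 : Continuous (mollify φ fun x => f (Φ q x 1)) :=
      continuous_iff_continuousAt.2 fun x => (hasFDerivAt_mollify φ (hcont q hq) x).continuousAt
    have hm : ∀ x, ‖mollify φ (fun x => f (Φ q x 1)) x - f (Φ q x 1)‖ ≤ L' * φ.rOut :=
      norm_mollify_sub_self_le (hcont q hq) hL'0 (hlip q hq)
    have hi1 : Integrable (fun ω => f (Φ q (X q ω) 1)) π :=
      Integrable.of_bound ((hcont q hq).comp_aestronglyMeasurable (hX.aestronglyMeasurable q hq)) M
        (Eventually.of_forall fun ω => hM _)
    have hi2 : Integrable (fun ω => mollify φ (fun x => f (Φ q x 1)) (X q ω)) π :=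
      Integrable.of_bound (hm1.comp_aestronglyMeasurable (hX.aestronglyMeasurable q hq))
        (M + L' * φ.rOut) (Eventually.of_forall fun ω => by
          have e1 := hm (X q ω)
          have e2 := hM (Φ q (X q ω) 1)
          have e3 := norm_sub_norm_le (mollify φ (fun x => f (Φ q x 1)) (X q ω))
            (f (Φ q (X q ω) 1))
          linarith)
    unfold transported
    rw [← integral_sub hi2 hi1]
    refine (norm_integral_le_of_norm_le_const (Eventually.of_forall fun ω => hm _)).trans ?_
    simp
  -- The flow started at time 1 has not moved, so both sides are values of the same unmollified
  -- expectation, at times 1 and 0.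
  have hf1 : ∫ ω, f (X 1 ω) ∂π = ∫ ω, f (Φ 1 (X 1 ω) 1) ∂π := by
    simp_rw [hΦ.init 1 h1]
  rw [hf1]
  set a := ∫ ω, f (Φ 1 (X 1 ω) 1) ∂π
  set b := ∫ ω, f (Φ 0 (X 0 ω) 1) ∂π
  have hbound : ∀ δ : ℝ, 0 < δ → ‖a - b‖ ≤ (2 * L' + L' * (K * Real.exp K)) * δ := fun δ hδ => by
    let φ : ContDiffBump (0 : E) := ⟨δ / 2, δ, half_pos hδ, half_lt_self hδ⟩
    have e1 : ‖transported φ π X Φ f 1 - a‖ ≤ L' * δ := hmoll φ 1 h1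
    have e2 : ‖transported φ π X Φ f 0 - b‖ ≤ L' * δ := hmoll φ 0 h0
    have e3 : ‖transported φ π X Φ f 1 - transported φ π X Φ f 0‖
      ≤ L' * (K * (Real.exp K * δ)) := hevol φ
    have e4 : a - b = (transported φ π X Φ f 1 - transported φ π X Φ f 0)
        - (transported φ π X Φ f 1 - a) + (transported φ π X Φ f 0 - b) := by abel
    rw [e4]
    refine (norm_add_le _ _).trans ((add_le_add ((norm_sub_le _ _).trans
      (add_le_add e3 e1)) e2).trans (le_of_eq ?_))
    ring
  have hz : ‖a - b‖ ≤ 0 := by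
    have hlim : Tendsto (fun δ : ℝ => (2 * L' + L' * (K * Real.exp K)) * δ) (𝓝[>] 0) (𝓝 0) := by
      have : Tendsto (fun δ : ℝ => (2 * L' + L' * (K * Real.exp K)) * δ) (𝓝 0)
          (𝓝 ((2 * L' + L' * (K * Real.exp K)) * 0)) := (continuous_const_mul _).tendsto 0
      rw [mul_zero] at this
      exact this.mono_left nhdsWithin_le_nhds
    exact ge_of_tendsto hlim (by filter_upwards [self_mem_nhdsWithin] with δ hδ using hbound δ hδ)
  exact sub_eq_zero.1 (norm_le_zero_iff.1 hz)

end Transport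

end Follmer


namespace Follmer

/-! ### Coercive symmetric operators -/

section Coercive

variable {E : Type*} [NormedAddCommGroup E] [InnerProductSpace ℝ E]

/-- A symmetric operator bounded below by `β > 0`. -/
structure IsCoerciveSymm (β : ℝ) (B : E →L[ℝ] E) : Prop where
  pos : 0 < β
  symm : ∀ x y, inner ℝ (B x) y = inner ℝ x (B y)
  le : ∀ x, β * ‖x‖ ^ 2 ≤ inner ℝ x (B x)

namespace IsCoerciveSymm

variable {β : ℝ} {B P Q : E →L[ℝ] E}

theorem norm_le (hB : IsCoerciveSymm β B) (x : E) : β * ‖x‖ ≤ ‖B x‖ := by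
  have h1 := (hB.le x).trans (real_inner_le_norm x (B x))
  rcases (norm_nonneg x).eq_or_lt with h | h
  · rw [← h]
    simp
  · nlinarith

/-- The weights are nonnegative and sum to 1, so the lower bound `β` is kept for every `c`; all
later estimates are uniform in time for this reason. -/
theorem convexComb (hP : IsCoerciveSymm β P) (hQ : IsCoerciveSymm β Q) {c : ℝ}
    (hc : c ∈ Icc (0 : ℝ) 1) : IsCoerciveSymm β ((1 - c ^ 2) • Q + c ^ 2 • P) := by
  have h1 : 0 ≤ 1 - c ^ 2 := by nlinarith [hc.1, hc.2]
  refine ⟨hP.pos, fun x y => ?_, fun x => ?_⟩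
  · simp [inner_add_left, inner_add_right, real_inner_smul_left, real_inner_smul_right, hP.symm,
      hQ.symm]
  · simp only [add_apply, smul_apply, inner_add_right, real_inner_smul_right]
    nlinarith [mul_le_mul_of_nonneg_left (hQ.le x) h1,
      mul_le_mul_of_nonneg_left (hP.le x) (sq_nonneg c)]

theorem isUnit [FiniteDimensional ℝ E] (hB : IsCoerciveSymm β B) : IsUnit B := by
  have := FiniteDimensional.complete ℝ E
  have hinj : Function.Injective B := by
    refine (injective_iff_map_eq_zero B).2 fun x hx => ?_
    have h1 := hB.norm_le x
    rw [hx, norm_zero] at h1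
    have h2 : ‖x‖ ≤ 0 := nonpos_of_mul_nonpos_right h1 hB.pos
    exact norm_le_zero_iff.1 h2
  exact ContinuousLinearMap.isUnit_iff_bijective.2
    ⟨hinj, (LinearMap.injective_iff_surjective (f := (B : E →ₗ[ℝ] E))).1 hinj⟩

theorem apply_inverse [FiniteDimensional ℝ E] (hB : IsCoerciveSymm β B) (x : E) :
    B (Ring.inverse B x) = x := by
  have := Ring.mul_inverse_cancel B hB.isUnit
  exact congrArg (fun T : E →L[ℝ] E => T x) this

theorem inverse_apply [FiniteDimensional ℝ E] (hB : IsCoerciveSymm β B) (x : E) :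
    Ring.inverse B (B x) = x := by
  have := Ring.inverse_mul_cancel B hB.isUnit
  exact congrArg (fun T : E →L[ℝ] E => T x) this

theorem norm_inverse_apply_le [FiniteDimensional ℝ E] (hB : IsCoerciveSymm β B) (x : E) :
    ‖Ring.inverse B x‖ ≤ β⁻¹ * ‖x‖ := by
  have h := hB.norm_le (Ring.inverse B x)
  rw [hB.apply_inverse] at h
  rwa [← div_eq_inv_mul, le_div_iff₀ hB.pos, mul_comm]

end IsCoerciveSymm

end Coercive

/-! ### Potentials with bounded Lipschitz gradient -/

section TameGradient

variable {E : Type*} [NormedAddCommGroup E] [InnerProductSpace ℝ E] [CompleteSpace E]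

/-- `h` has the bounded Lipschitz gradient `k`. -/
structure HasTameGradient (h : E → ℝ) (k : E → E) (M N : ℝ) : Prop where
  grad : ∀ x, HasGradientAt h (k x) x
  bound : ∀ x, ‖k x‖ ≤ M
  lip : ∀ x y, ‖k x - k y‖ ≤ N * ‖x - y‖

namespace HasTameGradient

variable {h : E → ℝ} {k : E → E} {M N : ℝ}

theorem nonneg (hh : HasTameGradient h k M N) : 0 ≤ M := (norm_nonneg _).trans (hh.bound 0)

theorem abs_sub_le (hh : HasTameGradient h k M N) (x y : E) : |h x - h y| ≤ M * ‖x - y‖ := by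
  have := convex_univ.norm_image_sub_le_of_norm_hasFDerivWithin_le
    (fun z _ => (hh.grad z).hasFDerivAt.hasFDerivWithinAt) (C := M)
    (fun z _ => by simpa using hh.bound z) (mem_univ y) (mem_univ x)
  simpa using this

theorem continuous (hh : HasTameGradient h k M N) : Continuous h :=
  continuous_of_norm_sub_le (L := M) fun x y => by simpa using hh.abs_sub_le x y

theorem continuous_grad (hh : HasTameGradient h k M N) : Continuous k :=
  continuous_of_norm_sub_le hh.lip

end HasTameGradient

end TameGradient

/-! ### Perturbed Gaussian weights and their tilted means -/

section Weights

variable {E : Type*} [NormedAddCommGroup E] [InnerProductSpace ℝ E] [FiniteDimensional ℝ E]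

/-- The density of a Gaussian perturbed by `h`, in rescaled variables. -/
noncomputable def weight (h : E → ℝ) (a : E) (σ : ℝ) (B : E →L[ℝ] E) (z : E) : ℝ :=
  Real.exp (h (a + σ • z) - inner ℝ z (B z) / 2)

namespace HasTameGradient

variable {h : E → ℝ} {k : E → E} {M N : ℝ}

theorem continuous_weight (hh : HasTameGradient h k M N) (a : E) (σ : ℝ) (B : E →L[ℝ] E) :
    Continuous (weight h a σ B) := by
  have := hh.continuous
  unfold weight
  fun_prop

theorem weight_le (hh : HasTameGradient h k M N) {β : ℝ} {B : E →L[ℝ] E} (hB : IsCoerciveSymm β B)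
    {a : E} {σ R r : ℝ} (ha : ‖a‖ ≤ R) (hσ : |σ| ≤ r) (z : E) :
    weight h a σ B z
      ≤ Real.exp (|h 0| + M * R) * Real.exp (M * r * ‖z‖ - β / 2 * ‖z‖ ^ 2) := by
  unfold weight
  rw [← Real.exp_add]
  refine Real.exp_le_exp.2 ?_
  have h1 := hh.abs_sub_le (a + σ • z) 0
  rw [sub_zero] at h1
  have h2 : ‖a + σ • z‖ ≤ R + r * ‖z‖ := by
    refine (norm_add_le _ _).trans ?_
    rw [norm_smul, Real.norm_eq_abs]
    gcongr
  have h3 := mul_le_mul_of_nonneg_left h2 hh.nonneg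
  have h4 := hB.le z
  have h5 := le_abs_self (h (a + σ • z) - h 0)
  have h6 := le_abs_self (h 0)
  linarith

/-- Shifting the centre multiplies the weight by exp(u) with |u| ≤ M ‖a - b‖ ≤ M, and |exp(u) - 1| ≤
|u| exp(|u|). A relative bound lets the normalising constant cancel later. -/
theorem abs_weight_sub_le (hh : HasTameGradient h k M N) {B : E →L[ℝ] E} {a b : E} (hab : ‖a - b‖ ≤ 1)
    (σ : ℝ) (z : E) :
    |weight h a σ B z - weight h b σ B z| ≤ M * Real.exp M * ‖a - b‖ * weight h b σ B z := by
  have h0 : 0 < weight h b σ B z := Real.exp_pos _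
  set u := h (a + σ • z) - h (b + σ • z) with hu
  have h1 : weight h a σ B z = Real.exp u * weight h b σ B z := by
    unfold weight
    rw [← Real.exp_add, hu]
    congr 1
    ring
  have h2 : |u| ≤ M * ‖a - b‖ := by
    have := hh.abs_sub_le (a + σ • z) (b + σ • z)
    rwa [add_sub_add_right_eq_sub] at this
  have h3 : |u| ≤ M := h2.trans (mul_le_of_le_one_right hh.nonneg hab)
  have h4 : |Real.exp u - 1| ≤ |u| * Real.exp |u| := by
    rw [abs_le]
    have e1 := Real.add_one_le_exp u
    have e2 := Real.add_one_le_exp (-u)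
    have e3 : Real.exp u * Real.exp (-u) = 1 := by rw [← Real.exp_add]; simp
    have e4 : Real.exp u ≤ Real.exp |u| := Real.exp_le_exp.2 (le_abs_self u)
    have e5 : 1 ≤ Real.exp |u| := Real.one_le_exp (abs_nonneg u)
    have e6 := Real.exp_pos u
    rcases abs_cases u with ⟨h, h'⟩ | ⟨h, h'⟩
    · rw [h] at *
      constructor <;> nlinarith
    · rw [h] at *
      constructor <;> nlinarith
  rw [h1, ← sub_one_mul, abs_mul, abs_of_pos h0]
  refine mul_le_mul_of_nonneg_right (h4.trans ?_) h0.le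
  calc |u| * Real.exp |u| ≤ (M * ‖a - b‖) * Real.exp M :=
        mul_le_mul h2 (Real.exp_le_exp.2 h3) (Real.exp_pos _).le ((abs_nonneg u).trans h2)
    _ = M * Real.exp M * ‖a - b‖ := by ring

theorem hasFDerivAt_weight (hh : HasTameGradient h k M N) {β : ℝ} {B : E →L[ℝ] E} (hB : IsCoerciveSymm β B) (a : E)
    (σ : ℝ) (z : E) : HasFDerivAt (weight h a σ B)
      (weight h a σ B z • innerSL ℝ (σ • k (a + σ • z) - B z)) z := by
  have h1 : HasFDerivAt (fun z : E => a + σ • z) (σ • ContinuousLinearMap.id ℝ E) z :=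
    ((hasFDerivAt_id z).const_smul σ).const_add a
  have h2 := ((hh.grad (a + σ • z)).hasFDerivAt.comp z h1).sub
    (((hasFDerivAt_id z).inner ℝ (B.hasFDerivAt (x := z))).const_mul (2⁻¹ : ℝ))
  have h3 := h2.exp
  have hw : weight h a σ B = fun z => Real.exp ((h ∘ fun z => a + σ • z) z
      - 2⁻¹ * inner ℝ (id z) (B z)) := by
    ext z
    simp [weight, div_eq_inv_mul]
  rw [hw]
  refine h3.congr_fderiv ?_
  ext v
  have e : inner ℝ z (B v) = inner ℝ v (B z) := by rw [← hB.symm, real_inner_comm]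
  have e' : inner ℝ (B z) v = inner ℝ v (B z) := real_inner_comm _ _
  simp [e, e']
  ring

end HasTameGradient

variable [MeasurableSpace E] [BorelSpace E]

theorem integrable_exp_neg_mul_sq_norm {b : ℝ} (hb : 0 < b) :
    Integrable fun z : E => Real.exp (-b * ‖z‖ ^ 2) := by
  have h := (GaussianFourier.integrable_cexp_neg_mul_sq_norm_add (V := E) (b := (b : ℂ))
    (by simpa using hb) 0 0).norm
  refine h.congr (Eventually.of_forall fun z => ?_)
  simp only [zero_mul, add_zero, Complex.norm_exp]
  congr 1
  norm_cast

theorem integrable_gaussian_envelope {β : ℝ} (hβ : 0 < β) (b : ℝ) :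
    Integrable fun z : E => (1 + ‖z‖) * Real.exp (b * ‖z‖ - β / 2 * ‖z‖ ^ 2) := by
  refine ((integrable_exp_neg_mul_sq_norm (E := E) (b := β / 4) (by positivity)).const_mul
    (Real.exp ((b + 1) ^ 2 / β))).mono' (by fun_prop) (Eventually.of_forall fun z => ?_)
  rw [Real.norm_of_nonneg (by positivity), ← Real.exp_add]
  have h1 : 1 + ‖z‖ ≤ Real.exp ‖z‖ := by linarith [Real.add_one_le_exp ‖z‖]
  refine (mul_le_mul_of_nonneg_right h1 (Real.exp_pos _).le).trans ?_
  rw [← Real.exp_add]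
  refine Real.exp_le_exp.2 ?_
  -- Completing the square gives (b + 1) r ≤ (b + 1)² / β + (β / 4) r², which leaves half of the
  -- Gaussian decay.
  have h2 : 0 ≤ ((b + 1) - β / 2 * ‖z‖) ^ 2 / β := by positivity
  have h3 : ((b + 1) - β / 2 * ‖z‖) ^ 2 / β
      = (b + 1) ^ 2 / β - (b + 1) * ‖z‖ + β / 4 * ‖z‖ ^ 2 := by
    field_simp
    ring
  linarith

namespace HasTameGradient

variable {h : E → ℝ} {k : E → E} {M N : ℝ}

theorem integrable_weight_smul (hh : HasTameGradient h k M N) {β : ℝ} {B : E →L[ℝ] E}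
    (hB : IsCoerciveSymm β B) (a : E) (σ : ℝ) {F : Type*} [NormedAddCommGroup F] [NormedSpace ℝ F]
    {g : E → F} (hg : AEStronglyMeasurable g volume) {c : ℝ} (hc : ∀ z, ‖g z‖ ≤ c * (1 + ‖z‖)) :
    Integrable fun z => weight h a σ B z • g z := by
  refine ((integrable_gaussian_envelope (E := E) hB.pos (M * |σ|)).const_mul
    (Real.exp (|h 0| + M * ‖a‖) * c)).mono'
    ((hh.continuous_weight a σ B).aestronglyMeasurable.smul hg) (Eventually.of_forall fun z => ?_)
  have h1 := hh.weight_le hB (le_refl ‖a‖) (le_refl |σ|) z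
  have h0 : 0 < weight h a σ B z := Real.exp_pos _
  rw [norm_smul, Real.norm_of_nonneg h0.le]
  refine (mul_le_mul h1 (hc z) (norm_nonneg _) (by positivity)).trans (le_of_eq ?_)
  ring

theorem integrable_weight (hh : HasTameGradient h k M N) {β : ℝ} {B : E →L[ℝ] E}
    (hB : IsCoerciveSymm β B) (a : E) (σ : ℝ) : Integrable (weight h a σ B) := by
  simpa using hh.integrable_weight_smul hB a σ (g := fun _ => (1 : ℝ)) (c := 1)
    aestronglyMeasurable_const (fun z => by simp)

theorem integrable_weight_smul_grad (hh : HasTameGradient h k M N) {β : ℝ} {B : E →L[ℝ] E}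
    (hB : IsCoerciveSymm β B) (a : E) (σ : ℝ) :
    Integrable fun z => weight h a σ B z • k (a + σ • z) := by
  refine hh.integrable_weight_smul hB a σ (c := M) ?_ fun z => ?_
  · have := hh.continuous_grad
    exact (by fun_prop : Continuous fun z => k (a + σ • z)).aestronglyMeasurable
  · have := hh.bound (a + σ • z)
    nlinarith [norm_nonneg z, hh.nonneg]

theorem integral_weight_pos (hh : HasTameGradient h k M N) {β : ℝ} {B : E →L[ℝ] E}
    (hB : IsCoerciveSymm β B) (a : E) (σ : ℝ) : 0 < ∫ z, weight h a σ B z :=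
  integral_exp_pos (hh.integrable_weight hB a σ)

end HasTameGradient

/-- The mean of `k` under the normalised weight. -/
noncomputable def tiltedMean (h : E → ℝ) (k : E → E) (a : E) (σ : ℝ) (B : E →L[ℝ] E) : E :=
  (∫ z, weight h a σ B z)⁻¹ • ∫ z, weight h a σ B z • k (a + σ • z)

namespace HasTameGradient

variable {h : E → ℝ} {k : E → E} {M N β : ℝ} {B : E →L[ℝ] E}

theorem integral_weight_smul_grad (hh : HasTameGradient h k M N) (hB : IsCoerciveSymm β B)
    (a : E) (σ : ℝ) : ∫ z, weight h a σ B z • k (a + σ • z)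
      = (∫ z, weight h a σ B z) • tiltedMean h k a σ B := by
  rw [tiltedMean, smul_smul, mul_inv_cancel₀ (hh.integral_weight_pos hB a σ).ne', one_smul]

theorem norm_tiltedMean_le (hh : HasTameGradient h k M N) (hB : IsCoerciveSymm β B)
    (a : E) (σ : ℝ) : ‖tiltedMean h k a σ B‖ ≤ M := by
  have hpos := hh.integral_weight_pos hB a σ
  rw [tiltedMean, norm_smul, norm_inv, Real.norm_of_nonneg hpos.le, inv_mul_le_iff₀ hpos,
    ← integral_mul_const]
  refine norm_integral_le_of_norm_le ((hh.integrable_weight hB a σ).mul_const M)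
    (Eventually.of_forall fun z => ?_)
  have h0 : 0 < weight h a σ B z := Real.exp_pos _
  rw [norm_smul, Real.norm_of_nonneg h0.le]
  exact mul_le_mul_of_nonneg_left (hh.bound _) h0.le

/-- For ‖a - b‖ > 1 the bound 2 M on the difference suffices. Otherwise, with G the tilted mean, the
difference is the average under the weight w_b of (w_a / w_b - 1) (k_a - G_a) + (k_a - k_b), whose
terms are at most 2 M² exp(M) ‖a - b‖ and |N| ‖a - b‖. The constant is free of `σ` and `B`, hence
uniform in time. -/
theorem norm_tiltedMean_sub_le (hh : HasTameGradient h k M N) (hB : IsCoerciveSymm β B)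
    (a b : E) (σ : ℝ) : ‖tiltedMean h k a σ B - tiltedMean h k b σ B‖
      ≤ (2 * M + 2 * M ^ 2 * Real.exp M + |N|) * ‖a - b‖ := by
  have hM := hh.nonneg
  have hnn := norm_nonneg (a - b)
  have hGa := hh.norm_tiltedMean_le hB a σ
  rcases le_or_gt ‖a - b‖ 1 with hab | hab
  swap
  · have h1 := (norm_sub_le (tiltedMean h k a σ B) (tiltedMean h k b σ B)).trans
      (add_le_add hGa (hh.norm_tiltedMean_le hB b σ))
    have h2 : 0 ≤ (2 * M ^ 2 * Real.exp M + |N|) * ‖a - b‖ := by positivity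
    nlinarith
  have hpos := hh.integral_weight_pos hB b σ
  have ia := hh.integrable_weight hB a σ
  have ib := hh.integrable_weight hB b σ
  have ja := hh.integrable_weight_smul_grad hB a σ
  have jb := hh.integrable_weight_smul_grad hB b σ
  have hid : tiltedMean h k a σ B - tiltedMean h k b σ B = (∫ z, weight h b σ B z)⁻¹ •
      ∫ z, (weight h a σ B z • k (a + σ • z) - weight h b σ B z • k (b + σ • z)
        - (weight h a σ B z - weight h b σ B z) • tiltedMean h k a σ B) := by
    have i1 : Integrable (fun z => weight h a σ B z • k (a + σ • z)
        - weight h b σ B z • k (b + σ • z)) := ja.sub jb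
    have i2 : Integrable (fun z => weight h a σ B z - weight h b σ B z) := ia.sub ib
    rw [integral_sub i1 (i2.smul_const _), integral_sub ja jb, integral_smul_const,
      integral_sub ia ib, hh.integral_weight_smul_grad hB a σ, hh.integral_weight_smul_grad hB b σ,
      eq_inv_smul_iff₀ hpos.ne']
    module
  rw [hid, norm_smul, norm_inv, Real.norm_of_nonneg hpos.le, inv_mul_le_iff₀ hpos,
    ← integral_mul_const]
  refine norm_integral_le_of_norm_le (ib.mul_const _) (Eventually.of_forall fun z => ?_)
  have h0 : 0 < weight h b σ B z := Real.exp_pos _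
  have hw := hh.abs_weight_sub_le (B := B) hab σ z
  have hka := hh.bound (a + σ • z)
  have hk : ‖k (a + σ • z) - k (b + σ • z)‖ ≤ |N| * ‖a - b‖ := by
    refine (hh.lip _ _).trans ?_
    rw [add_sub_add_right_eq_sub]
    gcongr
    exact le_abs_self N
  have hsplit : weight h a σ B z • k (a + σ • z) - weight h b σ B z • k (b + σ • z)
        - (weight h a σ B z - weight h b σ B z) • tiltedMean h k a σ B
      = (weight h a σ B z - weight h b σ B z) • (k (a + σ • z) - tiltedMean h k a σ B)
        + weight h b σ B z • (k (a + σ • z) - k (b + σ • z)) := by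
    module
  rw [hsplit]
  refine (norm_add_le _ _).trans ?_
  rw [norm_smul, norm_smul, Real.norm_eq_abs, Real.norm_of_nonneg h0.le]
  have hd : ‖k (a + σ • z) - tiltedMean h k a σ B‖ ≤ 2 * M := by
    refine (norm_sub_le _ _).trans ?_
    linarith
  refine (add_le_add (mul_le_mul hw hd (norm_nonneg _) (by positivity))
    (mul_le_mul_of_nonneg_left hk h0.le)).trans ?_
  have : 0 ≤ weight h b σ B z * (2 * M * ‖a - b‖) := by positivity
  nlinarith

/-- Dominated convergence: near a parameter, `a` and `σ` stay within 1 of their values in norm, and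
the common coercivity constant gives a single Gaussian envelope. -/
theorem continuous_integral_weight_smul (hh : HasTameGradient h k M N) {T : Type*}
    [TopologicalSpace T] [FirstCountableTopology T] {a : T → E} {σ : T → ℝ} {B : T → E →L[ℝ] E}
    (ha : Continuous a) (hσ : Continuous σ) (hBc : Continuous B)
    (hB : ∀ τ, IsCoerciveSymm β (B τ)) {F : Type*} [NormedAddCommGroup F] [NormedSpace ℝ F]
    {g : E → F} (hg : Continuous g) {C : ℝ} (hgb : ∀ x, ‖g x‖ ≤ C) :
    Continuous fun τ => ∫ z, weight h (a τ) (σ τ) (B τ) z • g (a τ + σ τ • z) := by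
  have hc := hh.continuous
  have hC : 0 ≤ C := (norm_nonneg _).trans (hgb 0)
  refine continuous_iff_continuousAt.2 fun τ₀ => ?_
  refine continuousAt_of_dominated (bound := fun z => Real.exp (|h 0| + M * (‖a τ₀‖ + 1))
    * C * ((1 + ‖z‖) * Real.exp (M * (|σ τ₀| + 1) * ‖z‖ - β / 2 * ‖z‖ ^ 2))) ?_ ?_ ?_ ?_
  · refine Eventually.of_forall fun τ => ?_
    have := hh.continuous_weight (a τ) (σ τ) (B τ)
    exact (by fun_prop : Continuous fun z => weight h (a τ) (σ τ) (B τ) z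
      • g (a τ + σ τ • z)).aestronglyMeasurable
  · filter_upwards [(ha.norm.tendsto τ₀).eventually_le_const (lt_add_one ‖a τ₀‖),
      (hσ.abs.tendsto τ₀).eventually_le_const (lt_add_one |σ τ₀|)] with τ h1 h2
    refine Eventually.of_forall fun z => ?_
    have h3 := hh.weight_le (hB τ) h1 h2 z
    have h0 : 0 < weight h (a τ) (σ τ) (B τ) z := Real.exp_pos _
    rw [norm_smul, Real.norm_of_nonneg h0.le]
    refine (mul_le_mul h3 (hgb _) (norm_nonneg _) (by positivity)).trans ?_
    have h4 : (1 : ℝ) ≤ 1 + ‖z‖ := by linarith [norm_nonneg z]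
    calc _ = Real.exp (|h 0| + M * (‖a τ₀‖ + 1)) * C
          * (1 * Real.exp (M * (|σ τ₀| + 1) * ‖z‖ - β / 2 * ‖z‖ ^ 2)) := by ring
      _ ≤ _ := by gcongr
  · exact (integrable_gaussian_envelope (hB τ₀).pos _).const_mul _
  · refine Eventually.of_forall fun z => ?_
    unfold weight
    exact (by fun_prop : Continuous fun τ => Real.exp (h (a τ + σ τ • z)
      - inner ℝ z ((B τ) z) / 2) • g (a τ + σ τ • z)).continuousAt

theorem continuous_tiltedMean (hh : HasTameGradient h k M N) {T : Type*} [TopologicalSpace T]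
    [FirstCountableTopology T] {a : T → E} {σ : T → ℝ} {B : T → E →L[ℝ] E} (ha : Continuous a)
    (hσ : Continuous σ) (hBc : Continuous B) (hB : ∀ τ, IsCoerciveSymm β (B τ)) :
    Continuous fun τ => tiltedMean h k (a τ) (σ τ) (B τ) := by
  have h1 : Continuous fun τ => ∫ z, weight h (a τ) (σ τ) (B τ) z := by
    simpa using hh.continuous_integral_weight_smul ha hσ hBc hB (g := fun _ => (1 : ℝ))
      continuous_const (C := 1) (fun x => by simp)
  have h2 := hh.continuous_integral_weight_smul ha hσ hBc hB hh.continuous_grad hh.bound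
  exact (h1.inv₀ fun τ => (hh.integral_weight_pos (hB τ) (a τ) (σ τ)).ne').smul h2

/-- Integration by parts against the weight. -/
theorem integral_weight_smul_apply (hh : HasTameGradient h k M N) (hB : IsCoerciveSymm β B)
    (a : E) (σ : ℝ) : B (∫ z, weight h a σ B z • z)
      = σ • ∫ z, weight h a σ B z • k (a + σ • z) := by
  have i0 : Integrable fun z => weight h a σ B z • z :=
    hh.integrable_weight_smul hB a σ (c := 1) aestronglyMeasurable_id (fun z => by simp)
  have i1 := hh.integrable_weight_smul_grad hB a σ
  have hzero : ∀ v : E, ∫ z, inner ℝ v (weight h a σ B z • (σ • k (a + σ • z) - B z)) = 0 := by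
    intro v
    have hder : ∀ z, fderiv ℝ (weight h a σ B) z v
        = inner ℝ v (weight h a σ B z • (σ • k (a + σ • z) - B z)) := fun z => by
      rw [(hh.hasFDerivAt_weight hB a σ z).fderiv]
      simp only [smul_apply, innerSL_apply_apply, smul_eq_mul, real_inner_smul_right]
      rw [real_inner_comm]
    have i2 : Integrable fun z => inner ℝ v (weight h a σ B z • (σ • k (a + σ • z) - B z)) := by
      have : Integrable fun z => weight h a σ B z • (σ • k (a + σ • z) - B z) := by
        have := (i1.smul σ).sub (B.integrable_comp i0)
        refine this.congr (Eventually.of_forall fun z => ?_)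
        simp only [Pi.sub_apply, Pi.smul_apply, map_smul]
        module
      exact this.const_inner v
    -- Parts against the constant 1: the directional derivative of an integrable weight has integral
    -- zero when it is itself integrable.
    have := integral_mul_fderiv_eq_neg_fderiv_mul_of_integrable (μ := (volume : Measure E))
      (f := fun _ : E => (1 : ℝ)) (g := weight h a σ B) (v := v) (by simp)
      (by simpa only [one_mul, hder] using i2) (by simpa using hh.integrable_weight hB a σ)
      (fun x _ => by fun_prop) (fun x _ => (hh.hasFDerivAt_weight hB a σ x).differentiableAt)
    simpa [hder] using this
  have j0 : Integrable fun z => B (weight h a σ B z • z) := B.integrable_comp i0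
  have j1 : Integrable fun z => σ • weight h a σ B z • k (a + σ • z) := i1.smul σ
  have j2 : Integrable fun z => B (weight h a σ B z • z)
      - σ • weight h a σ B z • k (a + σ • z) := j0.sub j1
  refine ext_inner_left ℝ fun v => ?_
  rw [← B.integral_comp_comm i0, ← integral_smul, ← sub_eq_zero, ← inner_sub_right,
    ← integral_sub j0 j1, ← integral_inner j2, ← neg_eq_zero, ← integral_neg, ← hzero v]
  refine integral_congr_ae (Eventually.of_forall fun z => ?_)
  simp only [map_smul]
  rw [← inner_neg_right]
  congr 1
  module

end HasTameGradient

end Weights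

end Follmer


namespace Follmer

/-! ### The posterior law and the regularised velocity field -/

section Drift

variable {E : Type*} [NormedAddCommGroup E] [InnerProductSpace ℝ E]

/-- The precision operator interpolating between `Q` and `P`. -/
def precision (P Q : E →L[ℝ] E) (c : ℝ) : E →L[ℝ] E := (1 - c ^ 2) • Q + c ^ 2 • P

/-- The unnormalised joint density of the position `x` at time `c` and the endpoint `y`. -/
noncomputable def jointKernel (P Q : E →L[ℝ] E) (h : E → ℝ) (c : ℝ) (x y : E) : ℝ :=
  Real.exp (-(1 - c ^ 2)⁻¹ * inner ℝ (x - c • y) (P (x - c • y)) / 2) * weight h 0 1 Q y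

theorem jointKernel_pos (P Q : E →L[ℝ] E) (h : E → ℝ) (c : ℝ) (x y : E) :
    0 < jointKernel P Q h c x y :=
  mul_pos (Real.exp_pos _) (Real.exp_pos _)

variable {P Q : E →L[ℝ] E} {h : E → ℝ} {k : E → E} {M N β : ℝ}

theorem one_sub_sq_pos {c : ℝ} (hc : c ∈ Ico (0 : ℝ) 1) : 0 < 1 - c ^ 2 := by
  nlinarith [hc.1, hc.2]

/-- Completing the square in the joint density. -/
theorem jointKernel_completion [FiniteDimensional ℝ E] (hP : IsCoerciveSymm β P) (hQ : IsCoerciveSymm β Q) {c : ℝ}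
    (hc : c ∈ Ico (0 : ℝ) 1) (x z : E) :
    jointKernel P Q h c x (c • Ring.inverse (precision P Q c) (P x) + √(1 - c ^ 2) • z)
      = jointKernel P Q h c x (c • Ring.inverse (precision P Q c) (P x))
        * Real.exp (-h (c • Ring.inverse (precision P Q c) (P x)))
        * weight h (c • Ring.inverse (precision P Q c) (P x)) (√(1 - c ^ 2)) (precision P Q c) z := by
  have hτ := one_sub_sq_pos hc
  have hB : IsCoerciveSymm β (precision P Q c) := hP.convexComb hQ (Ico_subset_Icc_self hc)
  set m := c • Ring.inverse (precision P Q c) (P x) with hm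
  set σ := √(1 - c ^ 2) with hσ
  have hσ2 : σ ^ 2 = 1 - c ^ 2 := Real.sq_sqrt hτ.le
  -- The centre `m` is the stationary point of the quadratic part of the exponent in y; this
  -- equation cancels the cross terms between `m` and `z`.
  have hBm : precision P Q c m = c • P x := by
    rw [hm, map_smul, hB.apply_inverse]
  unfold jointKernel weight
  simp only [← Real.exp_add]
  congr 1
  simp only [zero_add, one_smul]
  have hxz : inner ℝ z (precision P Q c m) = c * inner ℝ z (P x) := by
    rw [hBm, real_inner_smul_right]
  simp only [precision, add_apply, smul_apply, inner_add_right, real_inner_smul_right] at hxz ⊢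
  have e1 : x - c • (m + σ • z) = (x - c • m) - (c * σ) • z := by module
  have s1 : inner ℝ m (P z) = inner ℝ z (P m) := by rw [← hP.symm, real_inner_comm]
  have s2 : inner ℝ m (Q z) = inner ℝ z (Q m) := by rw [← hQ.symm, real_inner_comm]
  have s3 : inner ℝ x (P z) = inner ℝ z (P x) := by rw [← hP.symm, real_inner_comm]
  rw [e1]
  simp only [map_sub, map_add, map_smul, inner_sub_left, inner_sub_right, inner_add_left,
    inner_add_right, real_inner_smul_left, real_inner_smul_right, s1, s2, s3]
  have hne : 1 - c ^ 2 ≠ 0 := hτ.ne'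
  rw [← hσ2] at hxz hne ⊢
  have hσ0 : σ ≠ 0 := fun h => hne (by simp [h])
  field_simp
  linear_combination (-2 * σ) * hxz

theorem hasFDerivAt_jointKernel (hP : IsCoerciveSymm β P) (c : ℝ) (x y : E) :
    HasFDerivAt (fun x => jointKernel P Q h c x y)
      (jointKernel P Q h c x y • innerSL ℝ (-(1 - c ^ 2)⁻¹ • P (x - c • y))) x := by
  have h0 : HasFDerivAt (fun x : E => x - c • y) (ContinuousLinearMap.id ℝ E) x :=
    (hasFDerivAt_id x).sub_const _
  have h1 := (((h0.inner ℝ (P.hasFDerivAt.comp x h0)).const_mul (-(1 - c ^ 2)⁻¹ / 2)).exp).mul_const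
    (weight h 0 1 Q y)
  have hw : (fun x => jointKernel P Q h c x y) = fun x => Real.exp (-(1 - c ^ 2)⁻¹ / 2 *
      inner ℝ (x - c • y) ((P ∘ fun x => x - c • y) x)) * weight h 0 1 Q y := by
    ext x
    simp only [jointKernel, Function.comp_apply]
    congr 2
    ring
  rw [hw]
  refine h1.congr_fderiv ?_
  ext v
  have e : inner ℝ (x - c • y) (P v) = inner ℝ (P (x - c • y)) v := (hP.symm _ _).symm
  have e' : inner ℝ v (P (x - c • y)) = inner ℝ (P (x - c • y)) v := real_inner_comm _ _
  have e2 : jointKernel P Q h c x y = Real.exp (-(1 - c ^ 2)⁻¹ / 2 *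
      inner ℝ (x - c • y) (P (x - c • y))) * weight h 0 1 Q y := congrFun hw x
  simp only [smul_apply, ContinuousLinearMap.comp_apply, ContinuousLinearMap.prod_apply,
    fderivInnerCLM_apply, ContinuousLinearMap.id_apply, innerSL_apply_apply, smul_eq_mul,
    Function.comp_apply, real_inner_smul_left, e, e', e2]
  ring

variable [FiniteDimensional ℝ E] [MeasurableSpace E] [BorelSpace E]

/-- The velocity field of the interpolation, in a form that makes sense up to time one. -/
noncomputable def drift (P Q : E →L[ℝ] E) (h : E → ℝ) (k : E → E) (c : ℝ) (x : E) : E :=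
  Ring.inverse (precision P Q c) (c • (P - Q) x +
    tiltedMean h k (c • Ring.inverse (precision P Q c) (P x)) (√(1 - c ^ 2)) (precision P Q c))

theorem continuous_drift (hh : HasTameGradient h k M N) (hP : IsCoerciveSymm β P)
    (hQ : IsCoerciveSymm β Q) :
    Continuous fun p : Icc (0 : ℝ) 1 × E => drift P Q h k p.1 p.2 := by
  have hB : ∀ p : Icc (0 : ℝ) 1 × E, IsCoerciveSymm β (precision P Q p.1) :=
    fun p => hP.convexComb hQ p.1.2
  have hBc : Continuous fun p : Icc (0 : ℝ) 1 × E => precision P Q p.1 := by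
    unfold precision
    fun_prop
  have hinv : Continuous fun p : Icc (0 : ℝ) 1 × E => Ring.inverse (precision P Q p.1) := by
    refine continuous_iff_continuousAt.2 fun p => ?_
    obtain ⟨u, hu⟩ := (hB p).isUnit
    have h1 : ContinuousAt Ring.inverse (precision P Q p.1) := by
      rw [← hu]
      exact NormedRing.inverse_continuousAt u
    exact ContinuousAt.comp (f := fun p : Icc (0 : ℝ) 1 × E => precision P Q p.1) h1
      hBc.continuousAt
  have hG := hh.continuous_tiltedMean (T := Icc (0 : ℝ) 1 × E)
    (a := fun p => (p.1 : ℝ) • Ring.inverse (precision P Q p.1) (P p.2))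
    (σ := fun p => √(1 - (p.1 : ℝ) ^ 2)) (by fun_prop) (by fun_prop) hBc hB
  unfold drift
  fun_prop

theorem norm_drift_sub_le (hh : HasTameGradient h k M N) (hP : IsCoerciveSymm β P)
    (hQ : IsCoerciveSymm β Q) {c : ℝ} (hc : c ∈ Icc (0 : ℝ) 1) (x y : E) :
    ‖drift P Q h k c x - drift P Q h k c y‖ ≤ β⁻¹ * (‖P - Q‖
      + (2 * M + 2 * M ^ 2 * Real.exp M + |N|) * (β⁻¹ * ‖P‖)) * ‖x - y‖ := by
  have hB := hP.convexComb hQ hc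
  have hM := hh.nonneg
  have hβ := hP.pos
  unfold drift
  rw [← map_sub, mul_assoc]
  refine (hB.norm_inverse_apply_le _).trans (mul_le_mul_of_nonneg_left ?_ (by positivity))
  rw [add_sub_add_comm, add_mul]
  refine (norm_add_le _ _).trans (add_le_add ?_ ?_)
  · rw [← smul_sub, ← map_sub, norm_smul, Real.norm_of_nonneg hc.1]
    exact (mul_le_of_le_one_left (norm_nonneg ((P - Q) (x - y))) hc.2).trans
      ((P - Q).le_opNorm _)
  · refine (hh.norm_tiltedMean_sub_le hB _ _ _).trans ?_
    have hK : 0 ≤ 2 * M + 2 * M ^ 2 * Real.exp M + |N| := by positivity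
    refine (mul_le_mul_of_nonneg_left ?_ hK).trans (le_of_eq (mul_assoc _ _ _).symm)
    rw [← smul_sub, ← map_sub, ← map_sub, norm_smul, Real.norm_of_nonneg hc.1]
    refine (mul_le_of_le_one_left (norm_nonneg _) hc.2).trans
      ((hB.norm_inverse_apply_le _).trans ?_)
    rw [mul_assoc]
    exact mul_le_mul_of_nonneg_left (P.le_opNorm _) (by positivity)

theorem norm_drift_zero_le (hh : HasTameGradient h k M N) (hP : IsCoerciveSymm β P)
    (hQ : IsCoerciveSymm β Q) {c : ℝ} (hc : c ∈ Icc (0 : ℝ) 1) :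
    ‖drift P Q h k c 0‖ ≤ β⁻¹ * M := by
  have hB := hP.convexComb hQ hc
  have hβ := hP.pos
  refine (hB.norm_inverse_apply_le _).trans (mul_le_mul_of_nonneg_left ?_ (by positivity))
  rw [map_zero, smul_zero, zero_add]
  exact hh.norm_tiltedMean_le hB _ _

/-- At `c = 1` the posterior scale √(1 - c²) vanishes, so the tilted mean collapses to the value of
`k` at `x`. -/
theorem drift_one (hh : HasTameGradient h k M N) (hP : IsCoerciveSymm β P) (x : E) :
    drift P Q h k 1 x = x + Ring.inverse P (k x - Q x) := by
  have h1 : precision P Q 1 = P := by simp [precision]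
  have h2 : tiltedMean h k x 0 P = k x := by
    rw [tiltedMean, inv_smul_eq_iff₀ (hh.integral_weight_pos hP x 0).ne']
    simp [integral_smul_const]
  unfold drift
  rw [h1]
  simp only [one_pow, sub_self, Real.sqrt_zero, one_smul, hP.inverse_apply, h2]
  rw [← hP.inverse_apply x, ← map_add, hP.inverse_apply]
  congr 1
  simp only [sub_apply]
  abel

/-- The substitution y = m + σ z. The same `κ` serves the mass and every moment, so it cancels in
conditional expectations. -/
theorem integral_jointKernel_smul (hP : IsCoerciveSymm β P) (hQ : IsCoerciveSymm β Q) {c : ℝ}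
    (hc : c ∈ Ico (0 : ℝ) 1) (x : E) : ∃ κ : ℝ, 0 < κ ∧
    (∫ y, jointKernel P Q h c x y = κ * ∫ z, weight h (c • Ring.inverse (precision P Q c) (P x))
      (√(1 - c ^ 2)) (precision P Q c) z) ∧
    ∀ g : E → E, ∫ y, jointKernel P Q h c x y • g y
      = κ • ∫ z, weight h (c • Ring.inverse (precision P Q c) (P x)) (√(1 - c ^ 2))
        (precision P Q c) z • g (c • Ring.inverse (precision P Q c) (P x) + √(1 - c ^ 2) • z) := by
  have hσ : 0 < √(1 - c ^ 2) := Real.sqrt_pos.2 (one_sub_sq_pos hc)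
  have hcomp := jointKernel_completion (h := h) hP hQ hc x
  generalize c • Ring.inverse (precision P Q c) (P x) = m at *
  generalize √(1 - c ^ 2) = σ at *
  set κ₀ := jointKernel P Q h c x m * Real.exp (-h m) with hκ₀
  have hκ₀pos : 0 < κ₀ := mul_pos (jointKernel_pos _ _ _ _ _ _) (Real.exp_pos _)
  have hd : 0 < σ ^ Module.finrank ℝ E := pow_pos hσ _
  refine ⟨σ ^ Module.finrank ℝ E * κ₀, by positivity, ?_, fun g => ?_⟩
  · have h1 := Measure.integral_comp_smul (volume : Measure E)
      (fun y => jointKernel P Q h c x (m + y)) σ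
    rw [integral_add_left_eq_self (fun y => jointKernel P Q h c x y) m] at h1
    simp only [hcomp, integral_const_mul] at h1
    rw [mul_assoc, h1, abs_of_pos (inv_pos.2 hd), smul_eq_mul, mul_inv_cancel_left₀ hd.ne']
  · have h1 := Measure.integral_comp_smul (volume : Measure E)
      (fun y => jointKernel P Q h c x (m + y) • g (m + y)) σ
    rw [integral_add_left_eq_self (fun y => jointKernel P Q h c x y • g y) m] at h1
    simp only [hcomp, mul_smul _ (weight _ _ _ _ _), integral_smul] at h1
    rw [mul_smul, h1, abs_of_pos (inv_pos.2 hd), smul_smul, mul_inv_cancel₀ hd.ne', one_smul]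

/-- The drift is the conditional mean of `(Y - c X) / (1 - c²)` given the position `X = x`. -/
theorem integral_jointKernel_smul_sub (hh : HasTameGradient h k M N) (hP : IsCoerciveSymm β P)
    (hQ : IsCoerciveSymm β Q) {c : ℝ} (hc : c ∈ Ico (0 : ℝ) 1) (x : E) :
    ∫ y, jointKernel P Q h c x y • ((1 - c ^ 2)⁻¹ • (y - c • x))
      = (∫ y, jointKernel P Q h c x y) • drift P Q h k c x := by
  have hτ := one_sub_sq_pos hc
  have hB : IsCoerciveSymm β (precision P Q c) := hP.convexComb hQ (Ico_subset_Icc_self hc)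
  obtain ⟨κ, -, h1, h2⟩ := integral_jointKernel_smul (h := h) hP hQ hc x
  rw [h1, h2, mul_smul]
  congr 1
  -- Since P x - B x = (1 - c²) (P - Q) x, the shift carries a factor that cancels the singular 1 /
  -- (1 - c²). The fluctuation part gains the same factor σ² = 1 - c², one σ from scaling and one
  -- from integration by parts.
  have hshift : c • Ring.inverse (precision P Q c) (P x) - c • x
      = (1 - c ^ 2) • c • Ring.inverse (precision P Q c) ((P - Q) x) := by
    have e : (1 - c ^ 2) • (P - Q) x = P x - precision P Q c x := by
      simp only [precision, add_apply, smul_apply, sub_apply]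
      module
    rw [smul_comm, ← map_smul _ (1 - c ^ 2), e, map_sub, hB.inverse_apply, smul_sub]
  have hσ2 : √(1 - c ^ 2) * √(1 - c ^ 2) = 1 - c ^ 2 := Real.mul_self_sqrt hτ.le
  have hσσ : ∀ u : E, ((1 - c ^ 2)⁻¹ * √(1 - c ^ 2)) • √(1 - c ^ 2) • u = u := fun u => by
    rw [smul_smul, mul_assoc, hσ2, inv_mul_cancel₀ hτ.ne', one_smul]
  unfold drift
  generalize c • Ring.inverse (precision P Q c) (P x) = m at *
  have i0 := hh.integrable_weight hB m (√(1 - c ^ 2))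
  have i1 : Integrable fun z => weight h m (√(1 - c ^ 2)) (precision P Q c) z • z :=
    hh.integrable_weight_smul hB m _ (c := 1) aestronglyMeasurable_id (fun z => by simp)
  have hibp := hh.integral_weight_smul_apply hB m (√(1 - c ^ 2))
  rw [hh.integral_weight_smul_grad hB] at hibp
  have hz : ∫ z, weight h m (√(1 - c ^ 2)) (precision P Q c) z • z
      = Ring.inverse (precision P Q c) (√(1 - c ^ 2) •
        (∫ z, weight h m (√(1 - c ^ 2)) (precision P Q c) z) •
          tiltedMean h k m (√(1 - c ^ 2)) (precision P Q c)) := by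
    rw [← hibp, hB.inverse_apply]
  have i2 : Integrable fun z => ((1 - c ^ 2)⁻¹ * √(1 - c ^ 2)) •
      weight h m (√(1 - c ^ 2)) (precision P Q c) z • z := i1.smul _
  have hsplit : ∀ z, weight h m (√(1 - c ^ 2)) (precision P Q c) z •
      ((1 - c ^ 2)⁻¹ • (m + √(1 - c ^ 2) • z - c • x))
      = weight h m (√(1 - c ^ 2)) (precision P Q c) z • ((1 - c ^ 2)⁻¹ • (m - c • x))
        + ((1 - c ^ 2)⁻¹ * √(1 - c ^ 2)) •
          weight h m (√(1 - c ^ 2)) (precision P Q c) z • z := fun z => by module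
  simp_rw [hsplit]
  rw [integral_add (i0.smul_const _) i2, integral_smul_const, integral_smul, hz, hshift,
    inv_smul_smul₀ hτ.ne', map_smul, map_smul, map_add, map_smul, hσσ, smul_add]

theorem integrable_jointKernel_smul (hh : HasTameGradient h k M N) (hP : IsCoerciveSymm β P)
    (hQ : IsCoerciveSymm β Q) {c : ℝ} (hc : c ∈ Ico (0 : ℝ) 1) (x : E) {F : Type*}
    [NormedAddCommGroup F] [NormedSpace ℝ F] {g : E → F} (hg : Continuous g) {C : ℝ}
    (hC : ∀ z, ‖g z‖ ≤ C * (1 + ‖z‖)) : Integrable fun y => jointKernel P Q h c x y • g y := by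
  have hτ := one_sub_sq_pos hc
  have hw := hh.continuous_weight 0 1 Q
  refine (hh.integrable_weight_smul hQ 0 1 hg.aestronglyMeasurable hC).norm.mono' ?_
    (Eventually.of_forall fun y => ?_)
  · unfold jointKernel
    exact (by fun_prop : Continuous fun y => (Real.exp (-(1 - c ^ 2)⁻¹ *
      inner ℝ (x - c • y) (P (x - c • y)) / 2) * weight h 0 1 Q y) • g y).aestronglyMeasurable
  · rw [norm_smul, norm_smul, jointKernel, norm_mul]
    gcongr
    refine mul_le_of_le_one_left (norm_nonneg _) ?_
    rw [Real.norm_of_nonneg (Real.exp_pos _).le, Real.exp_le_one_iff]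
    have := (mul_nonneg hP.pos.le (sq_nonneg ‖x - c • y‖)).trans (hP.le (x - c • y))
    have := mul_nonneg (inv_pos.2 hτ).le this
    linarith

theorem integrable_jointKernel (hh : HasTameGradient h k M N) (hP : IsCoerciveSymm β P)
    (hQ : IsCoerciveSymm β Q) {c : ℝ} (hc : c ∈ Ico (0 : ℝ) 1) (x : E) :
    Integrable fun y => jointKernel P Q h c x y := by
  simpa using integrable_jointKernel_smul hh hP hQ hc x (g := fun _ => (1 : ℝ)) continuous_const
    (C := 1) (fun z => by simp)

theorem integral_jointKernel_pos (hh : HasTameGradient h k M N) (hP : IsCoerciveSymm β P)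
    (hQ : IsCoerciveSymm β Q) {c : ℝ} (hc : c ∈ Ico (0 : ℝ) 1) (x : E) :
    0 < ∫ y, jointKernel P Q h c x y := by
  obtain ⟨κ, hκ, h1, -⟩ := integral_jointKernel_smul (h := h) hP hQ hc x
  rw [h1]
  exact mul_pos hκ (hh.integral_weight_pos (hP.convexComb hQ (Ico_subset_Icc_self hc)) _ _)

/-- A bound uniform in `r` makes the domination of the kernel's gradient independent of the
position. -/
theorem mul_exp_neg_sq_le {β : ℝ} (hβ : 0 < β) (r : ℝ) :
    r * Real.exp (-(β * r ^ 2) / 2) ≤ 1 + β⁻¹ := by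
  have h1 : r ≤ (1 + β⁻¹) * (1 + β * r ^ 2 / 2) := by
    have e1 : β⁻¹ * β = 1 := inv_mul_cancel₀ hβ.ne'
    have e2 : 0 ≤ β⁻¹ := (inv_pos.2 hβ).le
    have e3 : 0 ≤ β * r ^ 2 := by positivity
    nlinarith [sq_nonneg (r - 1)]
  have h2 : 1 + β * r ^ 2 / 2 ≤ Real.exp (β * r ^ 2 / 2) := by
    linarith [Real.add_one_le_exp (β * r ^ 2 / 2)]
  have h3 : 0 ≤ 1 + β⁻¹ := by positivity
  have h4 := h1.trans (mul_le_mul_of_nonneg_left h2 h3)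
  rw [neg_div, Real.exp_neg, ← div_eq_mul_inv, div_le_iff₀ (Real.exp_pos _)]
  exact h4

/-- Differentiation under the integral. The linear factor P(x - c y) is absorbed by the Gaussian
factor, so a multiple of the prior weight in y dominates for all x at once. -/
theorem hasGradientAt_integral_jointKernel (hh : HasTameGradient h k M N)
    (hP : IsCoerciveSymm β P) (hQ : IsCoerciveSymm β Q) {c : ℝ} (hc : c ∈ Ico (0 : ℝ) 1) (x : E) :
    HasGradientAt (fun x => ∫ y, jointKernel P Q h c x y)
      (∫ y, jointKernel P Q h c x y • (-(1 - c ^ 2)⁻¹ • P (x - c • y))) x := by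
  have hτ := one_sub_sq_pos hc
  have hw := hh.continuous_weight 0 1 Q
  have hwi := hh.integrable_weight hQ 0 1
  have hcg : Continuous fun y : E => -(1 - c ^ 2)⁻¹ • P (x - c • y) := by fun_prop
  have hgb : ∀ y : E, ‖-(1 - c ^ 2)⁻¹ • P (x - c • y)‖
      ≤ ((1 - c ^ 2)⁻¹ * ‖P‖ * (1 + ‖x‖)) * (1 + ‖y‖) := fun y => by
    rw [norm_smul, norm_neg, Real.norm_of_nonneg (inv_pos.2 hτ).le, mul_assoc, mul_assoc]
    refine mul_le_mul_of_nonneg_left ((P.le_opNorm _).trans ?_) (inv_pos.2 hτ).le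
    refine mul_le_mul_of_nonneg_left ((norm_sub_le _ _).trans ?_) (norm_nonneg _)
    rw [norm_smul, Real.norm_of_nonneg hc.1]
    nlinarith [norm_nonneg x, norm_nonneg y, mul_nonneg (norm_nonneg x) (norm_nonneg y),
      mul_le_of_le_one_left (norm_nonneg y) hc.2.le]
  have hint := integrable_jointKernel_smul hh hP hQ hc x hcg hgb
  have hmain := hasFDerivAt_integral_of_dominated_of_fderiv_le (μ := (volume : Measure E))
    (F := fun x y => jointKernel P Q h c x y)
    (F' := fun x y => jointKernel P Q h c x y • innerSL ℝ (-(1 - c ^ 2)⁻¹ • P (x - c • y)))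
    (x₀ := x) (s := univ)
    (bound := fun y => ((1 - c ^ 2)⁻¹ * ‖P‖ * (1 + β⁻¹)) * weight h 0 1 Q y) univ_mem
    (Eventually.of_forall fun x => (integrable_jointKernel hh hP hQ hc x).aestronglyMeasurable)
    (integrable_jointKernel hh hP hQ hc x) ?_ ?_ (hwi.const_mul _)
    (Eventually.of_forall fun y x _ => hasFDerivAt_jointKernel hP c x y)
  · rw [hasGradientAt_iff_hasFDerivAt]
    refine hmain.congr_fderiv ?_
    have := (InnerProductSpace.toDual ℝ E).toContinuousLinearEquiv.toContinuousLinearMap.integral_comp_comm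
      hint
    refine Eq.trans ?_ this
    refine integral_congr_ae (Eventually.of_forall fun y => ?_)
    ext v
    simp
  · unfold jointKernel
    exact (by fun_prop : Continuous fun y => (Real.exp (-(1 - c ^ 2)⁻¹ *
      inner ℝ (x - c • y) (P (x - c • y)) / 2) * weight h 0 1 Q y) •
        innerSL ℝ (-(1 - c ^ 2)⁻¹ • P (x - c • y))).aestronglyMeasurable
  · refine Eventually.of_forall fun y x _ => ?_
    have h0 : 0 < weight h 0 1 Q y := Real.exp_pos _
    rw [norm_smul, innerSL_apply_norm, norm_smul, norm_neg,
      Real.norm_of_nonneg (inv_pos.2 hτ).le, Real.norm_of_nonneg (jointKernel_pos _ _ _ _ _ _).le,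
      jointKernel]
    set u := x - c • y
    have h1 : Real.exp (-(1 - c ^ 2)⁻¹ * inner ℝ u (P u) / 2)
        ≤ Real.exp (-(β * ‖u‖ ^ 2) / 2) := by
      refine Real.exp_le_exp.2 ?_
      have h2 := hP.le u
      have h3 : 1 ≤ (1 - c ^ 2)⁻¹ := (one_le_inv₀ hτ).2 (by nlinarith [sq_nonneg c])
      have h4 : 0 ≤ β * ‖u‖ ^ 2 := mul_nonneg hP.pos.le (sq_nonneg _)
      nlinarith
    have h5 := mul_exp_neg_sq_le hP.pos ‖u‖
    have h6 := P.le_opNorm u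
    have hβ := inv_pos.2 hP.pos
    calc _ = (1 - c ^ 2)⁻¹ * (‖P u‖ * Real.exp (-(1 - c ^ 2)⁻¹ * inner ℝ u (P u) / 2))
          * weight h 0 1 Q y := by ring
      _ ≤ (1 - c ^ 2)⁻¹ * ((‖P‖ * ‖u‖) * Real.exp (-(β * ‖u‖ ^ 2) / 2)) * weight h 0 1 Q y := by
          gcongr
      _ = (1 - c ^ 2)⁻¹ * (‖P‖ * (‖u‖ * Real.exp (-(β * ‖u‖ ^ 2) / 2))) * weight h 0 1 Q y := by
          ring
      _ ≤ _ := by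
          rw [mul_assoc ((1 - c ^ 2)⁻¹) ‖P‖]
          gcongr

end Drift

end Follmer


namespace Follmer

/-! ### From matrices to operators -/

section Matrices

variable {d : ℕ} {S C A : Matrix (Fin d) (Fin d) ℝ}

theorem act_mul_apply (M₁ M₂ : Matrix (Fin d) (Fin d) ℝ) (x : EuclideanSpace ℝ (Fin d)) :
    act M₁ (act M₂ x) = act (M₁ * M₂) x := by
  simp only [act]
  rw [map_mul]
  rfl

theorem act_one_apply (x : EuclideanSpace ℝ (Fin d)) :
    act (1 : Matrix (Fin d) (Fin d) ℝ) x = x := by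
  simp only [act]
  rw [map_one]
  rfl

theorem isUnit_det_sqrt (hS : S.PosDef) : IsUnit (CFC.sqrt S).det := by
  have h : (CFC.sqrt S).det * (CFC.sqrt S).det = S.det := by
    rw [← Matrix.det_mul, CFC.sqrt_mul_sqrt_self _ hS.posSemidef.nonneg]
  refine isUnit_iff_ne_zero.2 fun h0 => hS.det_pos.ne' ?_
  rw [← h, h0, zero_mul]

theorem isUnit_det (hS : S.PosDef) : IsUnit S.det := isUnit_iff_ne_zero.2 hS.det_pos.ne'

theorem act_inner_comm {M : Matrix (Fin d) (Fin d) ℝ} (hM : M.IsHermitian)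
    (x y : EuclideanSpace ℝ (Fin d)) : inner ℝ (act M x) y = inner ℝ x (act M y) := by
  have hsa : IsSelfAdjoint (act M) :=
    IsSelfAdjoint.map (f := Matrix.toEuclideanCLM (𝕜 := ℝ)) hM
  exact (ContinuousLinearMap.isSelfAdjoint_iff_isSymmetric.mp hsa) x y

/-- The form is ‖S^{-1/2} x‖², and ‖x‖ ≤ ‖S^{1/2}‖ ‖S^{-1/2} x‖. The summand 1 in the constant keeps
it positive in dimension 0 too. -/
theorem exists_isCoerciveSymm_inv (hS : S.PosDef) : ∃ β, IsCoerciveSymm β (act S⁻¹) := by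
  refine ⟨(1 + ‖act (CFC.sqrt S)‖ ^ 2)⁻¹, by positivity, act_inner_comm hS.isHermitian.inv,
    fun x => ?_⟩
  rw [← weightedNormSq_eq hS, weightedNormSq, real_inner_self_eq_norm_sq,
    inv_mul_le_iff₀ (by positivity)]
  have h1 := (act (CFC.sqrt S)).le_opNorm (act (CFC.sqrt S)⁻¹ x)
  rw [act_mul_apply, Matrix.mul_nonsing_inv _ (isUnit_det_sqrt hS), act_one_apply] at h1
  have h2 : ‖x‖ ^ 2 ≤ (‖act (CFC.sqrt S)‖ * ‖act (CFC.sqrt S)⁻¹ x‖) ^ 2 := by gcongr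
  nlinarith [sq_nonneg ‖act (CFC.sqrt S)⁻¹ x‖]

theorem IsCoerciveSymm.mono {E : Type*} [NormedAddCommGroup E] [InnerProductSpace ℝ E] {β γ : ℝ}
    {B : E →L[ℝ] E} (hB : IsCoerciveSymm β B) (hγ : 0 < γ) (h : γ ≤ β) : IsCoerciveSymm γ B :=
  ⟨hγ, hB.symm, fun x => (mul_le_mul_of_nonneg_right h (sq_nonneg _)).trans (hB.le x)⟩

theorem exists_isCoerciveSymm_inv_inv (hC : C.PosDef) (hA : A.PosDef) :
    ∃ β, IsCoerciveSymm β (act C⁻¹) ∧ IsCoerciveSymm β (act A⁻¹) := by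
  obtain ⟨β, hβ⟩ := exists_isCoerciveSymm_inv hC
  obtain ⟨γ, hγ⟩ := exists_isCoerciveSymm_inv hA
  have := lt_min hβ.pos hγ.pos
  exact ⟨min β γ, hβ.mono this (min_le_left _ _), hγ.mono this (min_le_right _ _)⟩

theorem inverse_act_inv (hC : C.PosDef) : Ring.inverse (act C⁻¹) = act C := by
  have h : act C⁻¹ * act C = 1 := by
    simp only [act]
    rw [← map_mul, Matrix.nonsing_inv_mul _ (isUnit_det hC), map_one]
  have h' : act C * act C⁻¹ = 1 := by
    simp only [act]
    rw [← map_mul, Matrix.mul_nonsing_inv _ (isUnit_det hC), map_one]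
  exact Ring.inverse_unit (⟨act C⁻¹, act C, h, h'⟩ : (EuclideanSpace ℝ (Fin d) →L[ℝ]
    EuclideanSpace ℝ (Fin d))ˣ)

theorem act_smul_apply (τ : ℝ) (M : Matrix (Fin d) (Fin d) ℝ) (x : EuclideanSpace ℝ (Fin d)) :
    act (τ • M) x = τ • act M x := by
  simp only [act]
  rw [map_smul]
  rfl

theorem exists_gaussianDensity_smul (hC : C.PosDef) {τ : ℝ} (hτ : 0 < τ) :
    ∃ κ : ℝ, 0 < κ ∧ ∀ x, gaussianDensity (τ • C) x
      = κ * Real.exp (-τ⁻¹ * inner ℝ x (act C⁻¹ x) / 2) := by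
  have hpd : (τ • C).PosDef := hC.smul hτ
  refine ⟨(√((2 * Real.pi) ^ d * (τ • C).det))⁻¹, ?_, fun x => ?_⟩
  · have := hpd.det_pos
    positivity
  · have hinv : (τ • C)⁻¹ = τ⁻¹ • C⁻¹ := by
      refine Matrix.inv_eq_right_inv ?_
      rw [Matrix.smul_mul, Matrix.mul_smul, Matrix.mul_nonsing_inv _ (isUnit_det hC), smul_smul,
        mul_inv_cancel₀ hτ.ne', one_smul]
    rw [gaussianDensity, weightedNormSq_eq hpd, hinv, act_smul_apply, real_inner_smul_right,
      neg_mul]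

end Matrices

/-! ### The Föllmer velocity equals the regularised drift -/

section Tail

variable {d : ℕ} {C A : Matrix (Fin d) (Fin d) ℝ} {h p₀ : EuclideanSpace ℝ (Fin d) → ℝ}

theorem GaussianTail.eq_weight (ht : GaussianTail C A h p₀) : p₀ = weight h 0 1 (act A⁻¹) := by
  ext x
  rw [ht.decomposition, weightedNormSq_eq ht.posDef, weight, ← Real.exp_add, zero_add, one_smul]
  congr 1
  ring

/-- Smoothness is assumed of `p₀` only; `h` inherits it as log p₀ plus a quadratic form. -/
theorem GaussianTail.contDiff_remainder (ht : GaussianTail C A h p₀) : ContDiff ℝ 2 h := by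
  have h1 : h = fun x => Real.log (p₀ x) + inner ℝ x (act A⁻¹ x) / 2 := by
    ext x
    rw [ht.eq_weight, weight, Real.log_exp, zero_add, one_smul]
    ring
  have h2 : ∀ x, p₀ x ≠ 0 := fun x => by
    rw [ht.eq_weight]
    exact (Real.exp_pos _).ne'
  rw [h1]
  exact (ht.contDiff.log h2).add ((contDiff_id.inner ℝ (act A⁻¹).contDiff).div_const 2)

theorem GaussianTail.exists_hasTameGradient (ht : GaussianTail C A h p₀) (hC : C.PosDef) :
    ∃ M N, HasTameGradient h (gradient h) M N := by
  obtain ⟨M, hM⟩ := ht.gradient_bounded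
  obtain ⟨N, hN⟩ := ht.hessian_bounded
  have hd := ht.contDiff_remainder
  have hgrad : Differentiable ℝ (gradient h) := by
    have h1 : ContDiff ℝ 1 (fderiv ℝ h) := hd.fderiv_right (by norm_num)
    have h2 : Differentiable ℝ (fderiv ℝ h) := h1.differentiable one_ne_zero
    exact (InnerProductSpace.toDual ℝ (EuclideanSpace ℝ (Fin d))).symm.toContinuousLinearEquiv.differentiable.comp h2
  refine ⟨‖act (CFC.sqrt C)⁻¹‖ * M, ‖act C⁻¹‖ * N, fun x => ?_, fun x => ?_, fun x y => ?_⟩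
  · exact (hd.differentiable two_ne_zero x).hasGradientAt
  · have h1 : gradient h x = act (CFC.sqrt C)⁻¹ (act (CFC.sqrt C) (gradient h x)) := by
      rw [act_mul_apply, Matrix.nonsing_inv_mul _ (isUnit_det_sqrt hC), act_one_apply]
    rw [h1]
    exact ((act _).le_opNorm _).trans (mul_le_mul_of_nonneg_left (hM x) (norm_nonneg _))
  · refine convex_univ.norm_image_sub_le_of_norm_fderiv_le (𝕜 := ℝ) (fun z _ => hgrad z)
      (fun z _ => ?_) (mem_univ y) (mem_univ x)
    have h1 : fderiv ℝ (gradient h) z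
        = (act C⁻¹).comp ((act C).comp (fderiv ℝ (gradient h) z)) := by
      ext1 v
      simp only [ContinuousLinearMap.comp_apply]
      rw [act_mul_apply, Matrix.nonsing_inv_mul _ (isUnit_det hC), act_one_apply]
    rw [h1]
    exact (ContinuousLinearMap.opNorm_comp_le _ _).trans
      (mul_le_mul_of_nonneg_left (hN z) (norm_nonneg _))

theorem reverseDensity_one (p₀ : EuclideanSpace ℝ (Fin d) → ℝ) : reverseDensity C p₀ 1 = p₀ := by
  ext x
  simp [reverseDensity, forwardDensity]

theorem exists_reverseDensity_eq (ht : GaussianTail C A h p₀) (hC : C.PosDef) {c : ℝ}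
    (hc : c ∈ Ico (0 : ℝ) 1) : ∃ κ : ℝ, 0 < κ ∧ ∀ x, reverseDensity C p₀ c x
      = κ * ∫ y, jointKernel (act C⁻¹) (act A⁻¹) h c x y := by
  obtain ⟨κ, hκ, hg⟩ := exists_gaussianDensity_smul hC (one_sub_sq_pos hc)
  refine ⟨κ, hκ, fun x => ?_⟩
  have h1 : (1 - c) * (2 - (1 - c)) = 1 - c ^ 2 := by ring
  have h2 : 1 - c ≠ 0 := (sub_pos.2 hc.2).ne'
  rw [reverseDensity, forwardDensity, if_neg h2, h1, sub_sub_cancel, ← integral_const_mul]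
  refine integral_congr_ae (Eventually.of_forall fun y => ?_)
  simp only [jointKernel, hg, ht.eq_weight]
  ring

theorem integral_law {p : EuclideanSpace ℝ (Fin d) → ℝ} (hp : IsProbDensity p)
    {F : Type*} [NormedAddCommGroup F] [NormedSpace ℝ F] (g : EuclideanSpace ℝ (Fin d) → F) :
    ∫ y, g y ∂(law p) = ∫ y, p y • g y := by
  have hm : AEMeasurable (fun x => ENNReal.ofReal (p x)) :=
    hp.2.1.aestronglyMeasurable.aemeasurable.ennreal_ofReal
  rw [law, integral_withDensity_eq_integral_toReal_smul₀ hm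
    (Eventually.of_forall fun _ => ENNReal.ofReal_lt_top)]
  simp only [ENNReal.toReal_ofReal (hp.1 _)]

/-- Tweedie's formula: for 0 < c < 1, C ∇ log p_c(x) = -(1 - c²)⁻¹ E[x - c Y | X_c = x], so (x + S)
/ c = (1 - c²)⁻¹ (E[Y | X_c = x] - c x), the posterior mean computed in
`integral_jointKernel_smul_sub`. The endpoints, where V or p_c is defined separately, are checked by
hand. -/
theorem velocity_eq_drift (hp : IsProbDensity p₀) (ht : GaussianTail C A h p₀) (hC : C.PosDef)
    {c : ℝ} (hc : c ∈ Icc (0 : ℝ) 1) (x : EuclideanSpace ℝ (Fin d)) :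
    velocity C p₀ c x = drift (act C⁻¹) (act A⁻¹) h (gradient h) c x := by
  obtain ⟨M, N, hh⟩ := ht.exists_hasTameGradient hC
  obtain ⟨β, hP, hQ⟩ := exists_isCoerciveSymm_inv_inv hC ht.posDef
  rcases hc.1.eq_or_lt with rfl | hc0
  · have h1 := integral_jointKernel_smul_sub hh hP hQ (left_mem_Ico.2 zero_lt_one) x
    -- At time 0 position and endpoint are independent: the kernel factorises and the posterior mean
    -- is the mean of the target.
    have h2 : ∀ y, jointKernel (act C⁻¹) (act A⁻¹) h 0 x y
        = Real.exp (-inner ℝ x (act C⁻¹ x) / 2) * p₀ y := fun y => by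
      rw [jointKernel, ht.eq_weight]
      simp
    simp only [h2, mul_smul, integral_smul, integral_const_mul, hp.2.2] at h1
    have h3 := smul_right_injective _ (Real.exp_pos (-inner ℝ x (act C⁻¹ x) / 2)).ne' h1
    rw [velocity, if_pos rfl, integral_law hp]
    simpa using h3
  rcases hc.2.eq_or_lt with rfl | hc1
  · rw [drift_one hh hP, inverse_act_inv hC, velocity, if_neg one_ne_zero, inv_one, one_smul, score,
      reverseDensity_one]
    congr 2
    -- At time 1 there is no convolution, and the score is read off the decomposition of `p₀`.
    have h1 : HasGradientAt (fun z => Real.log (p₀ z)) (gradient h x - act A⁻¹ x) x := by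
      have h2 := (hh.hasFDerivAt_weight hQ 0 1 x).log (Real.exp_pos _).ne'
      rw [hasGradientAt_iff_hasFDerivAt, ht.eq_weight]
      refine h2.congr_fderiv ?_
      have : weight h 0 1 (act A⁻¹) x ≠ 0 := (Real.exp_pos _).ne'
      ext v
      simp [this]
    exact h1.gradient
  · have hc' : c ∈ Ico (0 : ℝ) 1 := ⟨hc0.le, hc1⟩
    have hτ := one_sub_sq_pos hc'
    obtain ⟨κ, hκ, hrev⟩ := exists_reverseDensity_eq ht hC hc'
    have hD := integral_jointKernel_pos hh hP hQ hc' x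
    have hg := hasGradientAt_integral_jointKernel hh hP hQ hc' x
    have hpost := integral_jointKernel_smul_sub hh hP hQ hc' x
    set D := ∫ y, jointKernel (act C⁻¹) (act A⁻¹) h c x y with hDdef
    have i0 := integrable_jointKernel hh hP hQ hc' x
    have i1 : Integrable fun y => jointKernel (act C⁻¹) (act A⁻¹) h c x y • y :=
      integrable_jointKernel_smul hh hP hQ hc' x continuous_id (C := 1) (fun z => by simp)
    have i2 : Integrable fun y => jointKernel (act C⁻¹) (act A⁻¹) h c x y • (x - c • y) := by
      refine ((i0.smul_const x).sub (i1.smul c)).congr (Eventually.of_forall fun y => ?_)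
      simp only [Pi.sub_apply, Pi.smul_apply]
      module
    have i1c : Integrable fun y => c • jointKernel (act C⁻¹) (act A⁻¹) h c x y • y := i1.smul c
    have i0c : Integrable fun y => c • jointKernel (act C⁻¹) (act A⁻¹) h c x y • x :=
      (i0.smul_const x).smul c
    have hJ : ∫ y, jointKernel (act C⁻¹) (act A⁻¹) h c x y • (x - c • y)
        = D • x - c • ∫ y, jointKernel (act C⁻¹) (act A⁻¹) h c x y • y := by
      rw [hDdef, ← integral_smul_const, ← integral_smul,
        ← integral_sub (i0.smul_const x) i1c]
      refine integral_congr_ae (Eventually.of_forall fun y => ?_)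
      simp only
      module
    have hlog : gradient (fun z => Real.log (reverseDensity C p₀ c z)) x
        = D⁻¹ • ∫ y, jointKernel (act C⁻¹) (act A⁻¹) h c x y •
            (-(1 - c ^ 2)⁻¹ • act C⁻¹ (x - c • y)) := by
      refine HasGradientAt.gradient ?_
      have h1 : (fun z => Real.log (reverseDensity C p₀ c z)) = fun z => Real.log
          (κ * ∫ y, jointKernel (act C⁻¹) (act A⁻¹) h c z y) := by
        ext z
        rw [hrev]
      rw [h1, hasGradientAt_iff_hasFDerivAt]
      refine ((hg.hasFDerivAt.const_mul κ).log (mul_pos hκ hD).ne').congr_fderiv ?_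
      rw [← hDdef, smul_smul, mul_inv, mul_assoc, mul_comm κ⁻¹, mul_assoc, mul_inv_cancel₀ hκ.ne',
        mul_one, map_smul]
    have hCint : ∫ y, jointKernel (act C⁻¹) (act A⁻¹) h c x y •
            (-(1 - c ^ 2)⁻¹ • act C⁻¹ (x - c • y))
        = -(1 - c ^ 2)⁻¹ • act C⁻¹ (∫ y, jointKernel (act C⁻¹) (act A⁻¹) h c x y • (x - c • y)) := by
      rw [← ContinuousLinearMap.integral_comp_comm _ i2, ← integral_smul]
      refine integral_congr_ae (Eventually.of_forall fun y => ?_)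
      simp only [map_smul]
      module
    have hpost' : drift (act C⁻¹) (act A⁻¹) h (gradient h) c x = D⁻¹ • (1 - c ^ 2)⁻¹ •
        ((∫ y, jointKernel (act C⁻¹) (act A⁻¹) h c x y • y) - (c * D) • x) := by
      rw [eq_inv_smul_iff₀ hD.ne', ← hpost, hDdef, ← smul_smul, ← integral_smul_const,
        ← integral_smul, ← integral_sub i1 i0c, ← integral_smul]
      refine integral_congr_ae (Eventually.of_forall fun y => ?_)
      simp only
      module
    rw [velocity, if_neg hc0.ne', score, hlog, hCint, hJ, hpost', map_smul, map_smul,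
      act_mul_apply, Matrix.mul_nonsing_inv _ (isUnit_det hC), act_one_apply]
    generalize ∫ y, jointKernel (act C⁻¹) (act A⁻¹) h c x y • y = J
    clear_value D
    have hc0' := hc0.ne'
    have hD' := hD.ne'
    have hτ' := hτ.ne'
    match_scalars
    · field_simp
      ring
    · field_simp

theorem reverseDensity_pos (ht : GaussianTail C A h p₀) (hC : C.PosDef)
    {c : ℝ} (hc : c ∈ Icc (0 : ℝ) 1) (x : EuclideanSpace ℝ (Fin d)) :
    0 < reverseDensity C p₀ c x := by
  obtain ⟨M, N, hh⟩ := ht.exists_hasTameGradient hC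
  obtain ⟨β, hP, hQ⟩ := exists_isCoerciveSymm_inv_inv hC ht.posDef
  rcases hc.2.eq_or_lt with rfl | hc1
  · rw [reverseDensity_one, ht.eq_weight]
    exact Real.exp_pos _
  · obtain ⟨κ, hκ, hrev⟩ := exists_reverseDensity_eq ht hC ⟨hc.1, hc1⟩
    rw [hrev]
    exact mul_pos hκ (integral_jointKernel_pos hh hP hQ ⟨hc.1, hc1⟩ x)

theorem differentiableAt_reverseDensity (ht : GaussianTail C A h p₀) (hC : C.PosDef)
    {c : ℝ} (hc : c ∈ Icc (0 : ℝ) 1) (x : EuclideanSpace ℝ (Fin d)) :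
    DifferentiableAt ℝ (reverseDensity C p₀ c) x := by
  obtain ⟨M, N, hh⟩ := ht.exists_hasTameGradient hC
  obtain ⟨β, hP, hQ⟩ := exists_isCoerciveSymm_inv_inv hC ht.posDef
  rcases hc.2.eq_or_lt with rfl | hc1
  · rw [reverseDensity_one]
    exact ht.contDiff.differentiable two_ne_zero x
  · obtain ⟨κ, -, hrev⟩ := exists_reverseDensity_eq ht hC ⟨hc.1, hc1⟩
    rw [show reverseDensity C p₀ c = _ from funext hrev]
    exact ((hasGradientAt_integral_jointKernel hh hP hQ
      ⟨hc.1, hc1⟩ x).hasFDerivAt.differentiableAt).const_mul κ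

end Tail

end Follmer


namespace Follmer

/-! ### Gaussian densities and linear changes of variables -/

section Density

theorem exists_map_withDensity {V : Type*} [NormedAddCommGroup V] [NormedSpace ℝ V]
    [FiniteDimensional ℝ V] [MeasurableSpace V] [BorelSpace V] (μ : Measure V)
    [μ.IsAddHaarMeasure] (e : V ≃L[ℝ] V) {g : V → ℝ} (hg : Measurable g) :
    ∃ a : ℝ, 0 < a ∧ (μ.withDensity fun x => ENNReal.ofReal (g (e x))).map e
      = μ.withDensity fun x => ENNReal.ofReal (a * g x) := by
  have hdet : LinearMap.det (e.toLinearEquiv : V →ₗ[ℝ] V) ≠ 0 := e.toLinearEquiv.isUnit_det'.ne_zero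
  have he : Measurable e := e.continuous.measurable
  refine ⟨|(LinearMap.det (e.toLinearEquiv : V →ₗ[ℝ] V))⁻¹|, by positivity, ?_⟩
  have hmap : μ.map e = ENNReal.ofReal |(LinearMap.det (e.toLinearEquiv : V →ₗ[ℝ] V))⁻¹| • μ :=
    Measure.map_linearMap_addHaar_eq_smul_addHaar μ hdet
  ext s hs
  rw [Measure.map_apply he hs, withDensity_apply _ (he hs), withDensity_apply _ hs,
    ← setLIntegral_map (f := fun x => ENNReal.ofReal (g x)) hs hg.ennreal_ofReal he, hmap,
    Measure.restrict_smul, lintegral_smul_measure, smul_eq_mul,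
    ← lintegral_const_mul _ hg.ennreal_ofReal]
  simp only [ENNReal.ofReal_mul (abs_nonneg _)]

/-- Characteristic functions agree by the Gaussian Fourier integral. Dividing by its value at ξ = 0
removes the explicit normalising constant. -/
theorem exists_stdGaussian_eq_withDensity (E : Type*) [NormedAddCommGroup E]
    [InnerProductSpace ℝ E] [FiniteDimensional ℝ E] [MeasurableSpace E] [BorelSpace E] :
    ∃ κ : ℝ, 0 < κ ∧ stdGaussian E
      = (volume : Measure E).withDensity fun x => ENNReal.ofReal (κ * Real.exp (-‖x‖ ^ 2 / 2)) := by
  have hb : (0 : ℝ) < (1 / 2 : ℂ).re := by norm_num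
  set f : E → ℝ := fun x => Real.exp (-‖x‖ ^ 2 / 2) with hf
  have hform : ∀ ξ x : E, Complex.exp (-(1 / 2 : ℂ) * ‖x‖ ^ 2 + Complex.I * (inner ℝ ξ x : ℝ))
      = f x • Complex.exp ((inner ℝ x ξ : ℝ) * Complex.I) := fun ξ x => by
    rw [hf, Complex.real_smul, Complex.ofReal_exp, ← Complex.exp_add, real_inner_comm]
    congr 1
    push_cast
    ring
  have hint : Integrable f := by
    have h1 := GaussianFourier.integrable_cexp_neg_mul_sq_norm_add hb Complex.I (0 : E)
    have h2 := h1.norm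
    refine h2.congr (Eventually.of_forall fun x => ?_)
    simp only [hform, norm_smul, Complex.norm_exp_ofReal_mul_I, mul_one]
    exact Real.norm_of_nonneg (Real.exp_pos _).le
  have hpos : 0 < ∫ x, f x := integral_exp_pos hint
  have hfour : ∀ ξ : E, ∫ x, f x • Complex.exp ((inner ℝ x ξ : ℝ) * Complex.I)
      = (∫ x, f x : ℝ) * Complex.exp (-‖ξ‖ ^ 2 / 2) := fun ξ => by
    have h1 := GaussianFourier.integral_cexp_neg_mul_sq_norm_add hb Complex.I ξ
    have h2 := GaussianFourier.integral_cexp_neg_mul_sq_norm_add hb Complex.I (0 : E)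
    simp only [hform] at h1 h2
    simp only [inner_zero_right, Complex.ofReal_zero, zero_mul, Complex.exp_zero, norm_zero,
      ne_eq, OfNat.ofNat_ne_zero, not_false_eq_true, zero_pow, mul_zero, zero_div, mul_one] at h2
    rw [h1, ← h2, Complex.I_sq]
    congr 1
    · rw [← integral_complex_ofReal]
      refine integral_congr_ae (Eventually.of_forall fun x => ?_)
      simp
    · congr 1
      ring
  refine ⟨(∫ x, f x)⁻¹, inv_pos.2 hpos, ?_⟩
  have hm : Measurable fun x : E => (∫ x, f x)⁻¹ * f x := by
    rw [hf]
    fun_prop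
  have hnn : ∀ x, 0 ≤ (∫ x, f x)⁻¹ * f x := fun x =>
    mul_nonneg (inv_pos.2 hpos).le (Real.exp_pos _).le
  have : IsFiniteMeasure
      ((volume : Measure E).withDensity fun x => ENNReal.ofReal ((∫ x, f x)⁻¹ * f x)) :=
    isFiniteMeasure_withDensity_ofReal (hint.const_mul _).2
  refine Measure.ext_of_charFun ?_
  ext ξ
  rw [charFun_stdGaussian, charFun_apply, integral_withDensity_eq_integral_toReal_smul₀
    hm.ennreal_ofReal.aemeasurable (Eventually.of_forall fun _ => ENNReal.ofReal_lt_top)]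
  simp only [ENNReal.toReal_ofReal (hnn _), mul_smul, integral_smul]
  rw [hfour, Complex.real_smul, ← mul_assoc, ← Complex.ofReal_mul, inv_mul_cancel₀ hpos.ne',
    Complex.ofReal_one, one_mul]

end Density

section Gaussian

variable {d : ℕ} {C A : Matrix (Fin d) (Fin d) ℝ} {h p₀ : EuclideanSpace ℝ (Fin d) → ℝ}

/-- The law is the image of the standard Gaussian under √C, and ‖C^{-1/2} x‖² is the quadratic form
of C⁻¹. The constant is left implicit, since only its positivity matters. -/
theorem exists_multivariateGaussian_eq_withDensity (hC : C.PosDef) :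
    ∃ κ : ℝ, 0 < κ ∧ multivariateGaussian 0 C = volume.withDensity fun x =>
      ENNReal.ofReal (κ * Real.exp (-inner ℝ x (act C⁻¹ x) / 2)) := by
  obtain ⟨κ, hκ, hstd⟩ := exists_stdGaussian_eq_withDensity (EuclideanSpace ℝ (Fin d))
  have hu := isUnit_det_sqrt hC
  let e : EuclideanSpace ℝ (Fin d) ≃L[ℝ] EuclideanSpace ℝ (Fin d) :=
    ContinuousLinearEquiv.equivOfInverse (act (CFC.sqrt C)) (act (CFC.sqrt C)⁻¹)
      (fun x => by rw [act_mul_apply, Matrix.nonsing_inv_mul _ hu, act_one_apply])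
      (fun x => by rw [act_mul_apply, Matrix.mul_nonsing_inv _ hu, act_one_apply])
  obtain ⟨a, ha, hmap⟩ := exists_map_withDensity (volume : Measure (EuclideanSpace ℝ (Fin d))) e
    (g := fun x => κ * Real.exp (-inner ℝ x (act C⁻¹ x) / 2)) (by fun_prop)
  refine ⟨a * κ, mul_pos ha hκ, ?_⟩
  simp only [mul_assoc]
  rw [← hmap, multivariateGaussian, hstd]
  have h1 : (fun x => (0 : EuclideanSpace ℝ (Fin d)) + Matrix.toEuclideanCLM (𝕜 := ℝ) (CFC.sqrt C) x)
      = e := by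
    ext1 x
    rw [zero_add]
    rfl
  rw [h1]
  congr 2
  ext1 x
  have h2 : act (CFC.sqrt C)⁻¹ (e x) = x := e.symm_apply_apply x
  rw [← weightedNormSq_eq hC, weightedNormSq, h2, real_inner_self_eq_norm_sq]

theorem IsProbDensity.isProbabilityMeasure_law {p : EuclideanSpace ℝ (Fin d) → ℝ}
    (hp : IsProbDensity p) : IsProbabilityMeasure (law p) := by
  refine ⟨?_⟩
  rw [law, withDensity_apply _ MeasurableSet.univ, Measure.restrict_univ,
    ← ofReal_integral_eq_lintegral_ofReal hp.2.1 (Eventually.of_forall hp.1), hp.2.2,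
    ENNReal.ofReal_one]

theorem continuous_jointKernel (ht : GaussianTail C A h p₀) (c : ℝ) :
    Continuous fun z : EuclideanSpace ℝ (Fin d) × EuclideanSpace ℝ (Fin d) =>
      jointKernel (act C⁻¹) (act A⁻¹) h c z.2 z.1 := by
  have := ht.contDiff_remainder.continuous
  unfold jointKernel weight
  fun_prop

/-- The interpolation `(y, w) ↦ (y, c y + √(1 - c²) w)` as an automorphism. -/
theorem exists_interpolation_equiv {E : Type*} [NormedAddCommGroup E] [NormedSpace ℝ E] {c : ℝ}
    (hc : c ∈ Ico (0 : ℝ) 1) :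
    ∃ e : (E × E) ≃L[ℝ] (E × E), ∀ ω, e ω = (ω.1, c • ω.1 + √(1 - c ^ 2) • ω.2) := by
  have hσ : √(1 - c ^ 2) ≠ 0 := (Real.sqrt_pos.2 (one_sub_sq_pos hc)).ne'
  refine ⟨ContinuousLinearEquiv.equivOfInverse
    ((ContinuousLinearMap.fst ℝ E E).prod
      (c • ContinuousLinearMap.fst ℝ E E + √(1 - c ^ 2) • ContinuousLinearMap.snd ℝ E E))
    ((ContinuousLinearMap.fst ℝ E E).prod ((√(1 - c ^ 2))⁻¹ •
      (ContinuousLinearMap.snd ℝ E E - c • ContinuousLinearMap.fst ℝ E E)))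
    (fun ω => ?_) (fun ω => ?_), fun ω => rfl⟩
  · ext1 <;> simp [smul_smul, hσ]
  · ext1 <;> simp [smul_smul, hσ]

/-- This identifies the joint law of (Y, X_c): substituting W = (X_c - c Y) / √(1 - c²) in the
product density gives the joint kernel up to a Jacobian constant. -/
theorem exists_map_prod_eq_withDensity (hp : IsProbDensity p₀) (ht : GaussianTail C A h p₀)
    (hC : C.PosDef) {c : ℝ} (hc : c ∈ Ico (0 : ℝ) 1) :
    ∃ a : ℝ, 0 < a ∧ ((law p₀).prod (multivariateGaussian 0 C)).map
        (fun ω => (ω.1, c • ω.1 + √(1 - c ^ 2) • ω.2))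
      = (volume.prod volume).withDensity fun z =>
          ENNReal.ofReal (a * jointKernel (act C⁻¹) (act A⁻¹) h c z.2 z.1) := by
  obtain ⟨κ, hκ, hG⟩ := exists_multivariateGaussian_eq_withDensity hC
  obtain ⟨e, he⟩ := exists_interpolation_equiv (E := EuclideanSpace ℝ (Fin d)) hc
  have hτ := one_sub_sq_pos hc
  have hcont := continuous_jointKernel ht c
  obtain ⟨a, ha, hmap⟩ := exists_map_withDensity
    ((volume : Measure (EuclideanSpace ℝ (Fin d))).prod volume) e
    (g := fun z => κ * jointKernel (act C⁻¹) (act A⁻¹) h c z.2 z.1)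
    (hcont.measurable.const_mul κ)
  refine ⟨a * κ, mul_pos ha hκ, ?_⟩
  simp only [mul_assoc]
  rw [← hmap, show (fun ω : EuclideanSpace ℝ (Fin d) × EuclideanSpace ℝ (Fin d) =>
    (ω.1, c • ω.1 + √(1 - c ^ 2) • ω.2)) = e from (funext he).symm]
  congr 1
  have hm : Measurable p₀ := ht.contDiff.continuous.measurable
  rw [law, hG, prod_withDensity hm.ennreal_ofReal (by fun_prop)]
  congr 1
  ext1 ω
  rw [← ENNReal.ofReal_mul (hp.1 _), he]
  congr 1
  simp only [jointKernel, add_sub_cancel_left, map_smul, real_inner_smul_left,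
    real_inner_smul_right, ← ht.eq_weight]
  have h1 : -(1 - c ^ 2)⁻¹ * (√(1 - c ^ 2) * (√(1 - c ^ 2) * inner ℝ ω.2 (act C⁻¹ ω.2))) / 2
      = -inner ℝ ω.2 (act C⁻¹ ω.2) / 2 := by
    rw [← mul_assoc (√(1 - c ^ 2)), Real.mul_self_sqrt hτ.le]
    field_simp
  rw [h1]
  ring

end Gaussian

end Follmer


namespace Follmer

/-! ### The trigonometric interpolation as a random curve -/

section Interpolation

variable {E : Type*} [NormedAddCommGroup E] [InnerProductSpace ℝ E]

/-- The trigonometric interpolation from `w` at time `0` to `y` at time `1`. -/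
noncomputable def interpolation (t : ℝ) (ω : E × E) : E := t • ω.1 + √(1 - t ^ 2) • ω.2

/-- The time derivative of the interpolation. -/
noncomputable def interpolationDeriv (t : ℝ) (ω : E × E) : E := ω.1 - (t / √(1 - t ^ 2)) • ω.2

theorem hasDerivAt_interpolation {t : ℝ} (ht : t ∈ Ico (0 : ℝ) 1) (ω : E × E) :
    HasDerivAt (fun s => interpolation s ω) (interpolationDeriv t ω) t := by
  have h1 : HasDerivAt (fun s : ℝ => 1 - s ^ 2) (-(2 * t)) t := by
    simpa using (hasDerivAt_pow 2 t).const_sub 1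
  have h2 := ((hasDerivAt_id t).smul_const ω.1).add
    ((h1.sqrt (one_sub_sq_pos ht).ne').smul_const ω.2)
  refine h2.congr_deriv ?_
  rw [interpolationDeriv, one_smul, neg_div, neg_smul, ← sub_eq_add_neg,
    mul_div_mul_left _ _ two_ne_zero]

theorem continuous_interpolation (ω : E × E) : Continuous fun s => interpolation s ω := by
  unfold interpolation
  fun_prop

/-- √(1 - t²) - √(1 - s²) = (s² - t²) / (√(1 - t²) + √(1 - s²)). Only the root at `t` is kept in the
denominator, so `s` may reach 1; the constant blows up only as `t` tends to 1. -/
theorem norm_interpolation_sub_le {t : ℝ} (ht : t ∈ Ico (0 : ℝ) 1) (ω : E × E) {s : ℝ}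
    (hs : s ∈ Icc t 1) : ‖interpolation s ω - interpolation t ω‖
      ≤ (s - t) * (‖ω.1‖ + 2 / √(1 - t ^ 2) * ‖ω.2‖) := by
  have hτ := one_sub_sq_pos ht
  have hσ := Real.sqrt_pos.2 hτ
  have hst := sub_nonneg.2 hs.1
  have hs2 : 0 ≤ 1 - s ^ 2 := by nlinarith [hs.1, hs.2, ht.1]
  have hle : √(1 - s ^ 2) ≤ √(1 - t ^ 2) :=
    Real.sqrt_le_sqrt (by nlinarith [hs.1, hs.2, ht.1])
  have h1 : |√(1 - s ^ 2) - √(1 - t ^ 2)| ≤ (s - t) * (2 / √(1 - t ^ 2)) := by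
    rw [abs_sub_comm, abs_of_nonneg (sub_nonneg.2 hle), ← mul_div_assoc, le_div_iff₀ hσ]
    nlinarith [Real.mul_self_sqrt hs2, Real.mul_self_sqrt hτ.le, Real.sqrt_nonneg (1 - s ^ 2),
      mul_nonneg (sub_nonneg.2 hle) (Real.sqrt_nonneg (1 - s ^ 2)),
      mul_nonneg hst (by linarith [hs.2, ht.2] : 0 ≤ 2 - s - t)]
  have h2 : interpolation s ω - interpolation t ω
      = (s - t) • ω.1 + (√(1 - s ^ 2) - √(1 - t ^ 2)) • ω.2 := by
    unfold interpolation
    module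
  rw [h2, mul_add, ← mul_assoc]
  refine (norm_add_le _ _).trans (add_le_add ?_ ?_)
  · rw [norm_smul, Real.norm_of_nonneg hst]
  · rw [norm_smul, Real.norm_eq_abs]
    gcongr

theorem interpolationDeriv_eq {c : ℝ} (hc : c ∈ Ico (0 : ℝ) 1) (ω : E × E) :
    interpolationDeriv c ω = (1 - c ^ 2)⁻¹ • (ω.1 - c • interpolation c ω) := by
  have hτ := one_sub_sq_pos hc
  have hσ := Real.sqrt_pos.2 hτ
  rw [eq_inv_smul_iff₀ hτ.ne', interpolationDeriv, interpolation]
  have h1 : (1 - c ^ 2) * (c / √(1 - c ^ 2)) = c * √(1 - c ^ 2) := by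
    rw [← mul_div_assoc, div_eq_iff hσ.ne', mul_assoc, Real.mul_self_sqrt hτ.le, mul_comm]
  rw [smul_sub, smul_smul, h1]
  module

variable [MeasurableSpace E] {π : Measure (E × E)}

theorem memLp_interpolation (h1 : MemLp (fun ω : E × E => ω.1) 2 π)
    (h2 : MemLp (fun ω : E × E => ω.2) 2 π) (t : ℝ) : MemLp (interpolation t) 2 π :=
  (h1.const_smul t).add (h2.const_smul _)

theorem memLp_interpolationDeriv (h1 : MemLp (fun ω : E × E => ω.1) 2 π)
    (h2 : MemLp (fun ω : E × E => ω.2) 2 π) (t : ℝ) : MemLp (interpolationDeriv t) 2 π :=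
  h1.sub (h2.const_smul _)

theorem isDriftedCurve_interpolation (h1 : MemLp (fun ω : E × E => ω.1) 2 π)
    (h2 : MemLp (fun ω : E × E => ω.2) 2 π) {v : ℝ → E → E} {F : Type*} [NormedAddCommGroup F]
    [NormedSpace ℝ F]
    (hdrift : ∀ t ∈ Ico (0 : ℝ) 1, ∀ ψ : E → E →L[ℝ] F, Continuous ψ → (∃ c, ∀ x, ‖ψ x‖ ≤ c) →
      ∫ ω, ψ (interpolation t ω) (interpolationDeriv t ω) ∂π
        = ∫ ω, ψ (interpolation t ω) (v t (interpolation t ω)) ∂π) :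
    IsDriftedCurve π v interpolation interpolationDeriv F where
  aestronglyMeasurable t _ := (memLp_interpolation h1 h2 t).1
  aestronglyMeasurable_deriv t _ := (memLp_interpolationDeriv h1 h2 t).1
  continuousOn ω := (continuous_interpolation ω).continuousOn
  hasDeriv _ ht ω := (hasDerivAt_interpolation ht ω).hasDerivWithinAt
  increment _ ht := ⟨1, ⟨ht.2, le_rfl⟩, _, h1.norm.add (h2.norm.const_mul _),
    fun ω _ hs => norm_interpolation_sub_le ht ω hs⟩
  memLp t _ := memLp_interpolation h1 h2 t
  drift := hdrift

end Interpolation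

/-! ### The drift as conditional mean velocity -/

section Coupling

variable {d : ℕ} {C A : Matrix (Fin d) (Fin d) ℝ} {h p₀ : EuclideanSpace ℝ (Fin d) → ℝ}

theorem memLp_two_law (hp : IsProbDensity p₀)
    (hmoment : Integrable (fun x : EuclideanSpace ℝ (Fin d) => ‖x‖ ^ 3) (law p₀)) :
    MemLp (fun x : EuclideanSpace ℝ (Fin d) => x) 2 (law p₀) := by
  have := hp.isProbabilityMeasure_law
  rw [memLp_two_iff_integrable_sq_norm (by fun_prop)]
  refine ((integrable_const (1 : ℝ)).add hmoment).mono' (by fun_prop)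
    (Eventually.of_forall fun x => ?_)
  rw [Real.norm_of_nonneg (sq_nonneg _), Pi.add_apply]
  nlinarith [norm_nonneg x, mul_nonneg (norm_nonneg x) (sq_nonneg (‖x‖ - 1)),
    sq_nonneg (‖x‖ - 1)]

/-- The velocity is a function of (Y, X_c) by `interpolationDeriv_eq`. Under the joint density,
integrating first over the endpoint with the position fixed replaces it by its conditional mean,
which is the drift. -/
theorem integral_interpolation_drift (hp : IsProbDensity p₀) (ht : GaussianTail C A h p₀)
    (hC : C.PosDef)
    (hmoment : Integrable (fun x : EuclideanSpace ℝ (Fin d) => ‖x‖ ^ 3) (law p₀))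
    {c : ℝ} (hc : c ∈ Ico (0 : ℝ) 1) {F : Type*} [NormedAddCommGroup F] [NormedSpace ℝ F]
    [CompleteSpace F] {ψ : EuclideanSpace ℝ (Fin d) → EuclideanSpace ℝ (Fin d) →L[ℝ] F}
    (hψ : Continuous ψ) (hψb : ∃ b, ∀ x, ‖ψ x‖ ≤ b) :
    ∫ ω, ψ (interpolation c ω) (interpolationDeriv c ω) ∂(law p₀).prod (multivariateGaussian 0 C)
      = ∫ ω, ψ (interpolation c ω) (drift (act C⁻¹) (act A⁻¹) h (gradient h) c (interpolation c ω))
          ∂(law p₀).prod (multivariateGaussian 0 C) := by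
  obtain ⟨M, N, hh⟩ := ht.exists_hasTameGradient hC
  obtain ⟨β, hP, hQ⟩ := exists_isCoerciveSymm_inv_inv hC ht.posDef
  obtain ⟨b, hb⟩ := hψb
  have := hp.isProbabilityMeasure_law
  set π := (law p₀).prod (multivariateGaussian 0 C) with hπ
  set m := drift (act C⁻¹) (act A⁻¹) h (gradient h) c with hm
  obtain ⟨L, hm_lip⟩ : ∃ L, ∀ x y, ‖m x - m y‖ ≤ L * ‖x - y‖ :=
    ⟨_, norm_drift_sub_le hh hP hQ (Ico_subset_Icc_self hc)⟩
  have hm_cont : Continuous m := continuous_of_norm_sub_le hm_lip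
  have m1 : MemLp (fun ω : EuclideanSpace ℝ (Fin d) × EuclideanSpace ℝ (Fin d) => ω.1) 2 π :=
    (memLp_two_law hp hmoment).comp_fst _
  have m2 : MemLp (fun ω : EuclideanSpace ℝ (Fin d) × EuclideanSpace ℝ (Fin d) => ω.2) 2 π :=
    (IsGaussian.memLp_two_id (μ := multivariateGaussian 0 C)).comp_snd _
  have hX := (memLp_interpolation m1 m2 c).integrable one_le_two
  have hX' := (memLp_interpolationDeriv m1 m2 c).integrable one_le_two
  have hψX : AEStronglyMeasurable (fun ω => ψ (interpolation c ω)) π :=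
    hψ.comp_aestronglyMeasurable hX.1
  have happ : ∀ {u : EuclideanSpace ℝ (Fin d) × EuclideanSpace ℝ (Fin d) →
      EuclideanSpace ℝ (Fin d)}, Integrable u π →
      Integrable (fun ω => ψ (interpolation c ω) (u ω)) π := fun {u} hu => by
    have continuous_eval : Continuous fun p : (EuclideanSpace ℝ (Fin d) →L[ℝ] F) ×
        EuclideanSpace ℝ (Fin d) => p.1 p.2 := by fun_prop
    refine (hu.norm.const_mul b).mono' (continuous_eval.comp_aestronglyMeasurable
      (hψX.prodMk hu.1)) (Eventually.of_forall fun ω => ?_)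
    exact ((ψ _).le_opNorm _).trans (mul_le_mul_of_nonneg_right (hb _) (norm_nonneg _))
  have hmX : Integrable (fun ω => m (interpolation c ω)) π := by
    refine ((hX.norm.const_mul L).add (integrable_const ‖m 0‖)).mono'
      (hm_cont.comp_aestronglyMeasurable hX.1) (Eventually.of_forall fun ω => ?_)
    have h1 := hm_lip (interpolation c ω) 0
    rw [sub_zero] at h1
    exact (norm_le_norm_sub_add _ _).trans (add_le_add h1 le_rfl)
  rw [← sub_eq_zero, ← integral_sub (happ hX') (happ hmX)]
  obtain ⟨a, ha, hmap⟩ := exists_map_prod_eq_withDensity hp ht hC hc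
  set G : EuclideanSpace ℝ (Fin d) × EuclideanSpace ℝ (Fin d) → F :=
    fun z => ψ z.2 ((1 - c ^ 2)⁻¹ • (z.1 - c • z.2) - m z.2) with hG
  have hG_cont : Continuous G := by
    rw [hG]
    fun_prop
  set T : EuclideanSpace ℝ (Fin d) × EuclideanSpace ℝ (Fin d) →
    EuclideanSpace ℝ (Fin d) × EuclideanSpace ℝ (Fin d) :=
    fun ω => (ω.1, c • ω.1 + √(1 - c ^ 2) • ω.2) with hT
  have hT_meas : AEMeasurable T π := by
    rw [hT]
    fun_prop
  have hGT : ∀ ω, ψ (interpolation c ω) (interpolationDeriv c ω)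
      - ψ (interpolation c ω) (m (interpolation c ω)) = G (T ω) := fun ω => by
    rw [← map_sub, interpolationDeriv_eq hc]
    rfl
  have hGi : Integrable G (π.map T) := by
    rw [integrable_map_measure hG_cont.aestronglyMeasurable hT_meas]
    exact ((happ hX').sub (happ hmX)).congr (Eventually.of_forall hGT)
  simp only [hGT]
  rw [← integral_map hT_meas hG_cont.aestronglyMeasurable, hmap]
  rw [hmap] at hGi
  have hJ : Measurable fun z : EuclideanSpace ℝ (Fin d) × EuclideanSpace ℝ (Fin d) =>
      ENNReal.ofReal (a * jointKernel (act C⁻¹) (act A⁻¹) h c z.2 z.1) :=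
    ((continuous_jointKernel ht c).measurable.const_mul a).ennreal_ofReal
  have hJ0 : ∀ x y, 0 ≤ a * jointKernel (act C⁻¹) (act A⁻¹) h c x y := fun x y =>
    mul_nonneg ha.le (mul_nonneg (Real.exp_pos _).le (Real.exp_pos _).le)
  rw [integrable_withDensity_iff_integrable_smul₀' hJ.aemeasurable
    (Eventually.of_forall fun _ => ENNReal.ofReal_lt_top)] at hGi
  rw [integral_withDensity_eq_integral_toReal_smul₀ hJ.aemeasurable
    (Eventually.of_forall fun _ => ENNReal.ofReal_lt_top)]
  simp only [ENNReal.toReal_ofReal (hJ0 _ _)] at hGi ⊢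
  -- The position becomes the outer variable, so ψ is a fixed linear map in the inner integral and
  -- comes out of it.
  rw [integral_prod_symm _ hGi]
  refine integral_eq_zero_of_ae (Eventually.of_forall fun x => ?_)
  have i0 := integrable_jointKernel hh hP hQ hc x
  have i1 : Integrable fun y => jointKernel (act C⁻¹) (act A⁻¹) h c x y
      • ((1 - c ^ 2)⁻¹ • (y - c • x)) := by
    refine integrable_jointKernel_smul hh hP hQ hc x (by fun_prop)
      (C := |(1 - c ^ 2)⁻¹| * (1 + ‖c • x‖)) fun z => ?_
    rw [norm_smul, Real.norm_eq_abs, mul_assoc]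
    gcongr
    have := norm_sub_le z (c • x)
    nlinarith [norm_nonneg z, norm_nonneg (c • x), mul_nonneg (norm_nonneg z) (norm_nonneg (c • x))]
  have i2 : Integrable fun y => jointKernel (act C⁻¹) (act A⁻¹) h c x y • m x := i0.smul_const _
  have h1 : ∫ y, jointKernel (act C⁻¹) (act A⁻¹) h c x y
      • ((1 - c ^ 2)⁻¹ • (y - c • x) - m x) = 0 := by
    simp only [smul_sub _ _ (m x)]
    rw [integral_sub i1 i2, integral_jointKernel_smul_sub hh hP hQ hc, integral_smul_const,
      sub_self]
  have i3 : Integrable fun y => jointKernel (act C⁻¹) (act A⁻¹) h c x y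
      • ((1 - c ^ 2)⁻¹ • (y - c • x) - m x) :=
    (i1.sub i2).congr (Eventually.of_forall fun y => (smul_sub _ _ _).symm)
  have h2 := (ψ x).integral_comp_comm i3
  rw [h1, map_zero] at h2
  simp only [map_smul] at h2
  simp only [hG, mul_smul, integral_smul, Pi.zero_apply]
  rw [h2, smul_zero]

end Coupling

/-! ### Extension of the drift to all real times -/

section ExtendedDrift

variable {E : Type*} [NormedAddCommGroup E] [InnerProductSpace ℝ E] [FiniteDimensional ℝ E]
  [MeasurableSpace E] [BorelSpace E] {P Q : E →L[ℝ] E} {h : E → ℝ} {k : E → E} {M N β : ℝ}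

/-- The drift, extended to all times by its values at the endpoints of `[0, 1]`. -/
noncomputable def extendedDrift (P Q : E →L[ℝ] E) (h : E → ℝ) (k : E → E) (t : ℝ) (x : E) : E :=
  drift P Q h k (projIcc (0 : ℝ) 1 zero_le_one t) x

theorem extendedDrift_of_mem {t : ℝ} (ht : t ∈ Icc (0 : ℝ) 1) (x : E) :
    extendedDrift P Q h k t x = drift P Q h k t x := by
  rw [extendedDrift, projIcc_of_mem _ ht]

theorem continuous_extendedDrift (hh : HasTameGradient h k M N) (hP : IsCoerciveSymm β P)
    (hQ : IsCoerciveSymm β Q) : Continuous (Function.uncurry (extendedDrift P Q h k)) := by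
  have hproj : Continuous fun q : ℝ × E => (projIcc (0 : ℝ) 1 zero_le_one q.1, q.2) :=
    (continuous_projIcc.comp continuous_fst).prodMk continuous_snd
  have hcomp := (continuous_drift hh hP hQ).comp hproj
  refine hcomp.congr fun q => ?_
  rw [Function.comp_apply, Function.uncurry, extendedDrift]

theorem exists_lipschitzWith_extendedDrift (hh : HasTameGradient h k M N)
    (hP : IsCoerciveSymm β P) (hQ : IsCoerciveSymm β Q) :
    ∃ K, ∀ t, LipschitzWith K (extendedDrift P Q h k t) :=
  ⟨_, fun t => LipschitzWith.of_dist_le' fun x y => by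
    rw [dist_eq_norm, dist_eq_norm]
    exact norm_drift_sub_le hh hP hQ (projIcc (0 : ℝ) 1 zero_le_one t).2 x y⟩

theorem norm_extendedDrift_zero_le (hh : HasTameGradient h k M N) (hP : IsCoerciveSymm β P)
    (hQ : IsCoerciveSymm β Q) (t : ℝ) : ‖extendedDrift P Q h k t 0‖ ≤ β⁻¹ * M :=
  norm_drift_zero_le hh hP hQ (projIcc (0 : ℝ) 1 zero_le_one t).2

end ExtendedDrift

/-! ### The push-forward of the Gaussian law -/

section Transport

variable {d : ℕ} {C A : Matrix (Fin d) (Fin d) ℝ} {h p₀ : EuclideanSpace ℝ (Fin d) → ℝ}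

theorem norm_exp_inner_mul_I_sub_le {E : Type*} [NormedAddCommGroup E] [InnerProductSpace ℝ E]
    (ξ x y : E) : ‖Complex.exp ((inner ℝ x ξ : ℝ) * Complex.I)
      - Complex.exp ((inner ℝ y ξ : ℝ) * Complex.I)‖ ≤ ‖ξ‖ * ‖x - y‖ := by
  have h1 : Complex.exp ((inner ℝ x ξ : ℝ) * Complex.I) - Complex.exp ((inner ℝ y ξ : ℝ) * Complex.I)
      = Complex.exp ((inner ℝ y ξ : ℝ) * Complex.I)
        * (Complex.exp (Complex.I * (inner ℝ (x - y) ξ : ℝ)) - 1) := by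
    rw [mul_sub, mul_one, ← Complex.exp_add, inner_sub_left]
    congr 2
    push_cast
    ring
  rw [h1, norm_mul, Complex.norm_exp_ofReal_mul_I, one_mul]
  refine (Real.norm_exp_I_mul_ofReal_sub_one_le).trans ?_
  rw [mul_comm]
  exact norm_inner_le_norm _ _

/-- The test functions are characters, bounded by 1 and ‖ξ‖-Lipschitz. The interpolation is W at
time 0 and Y at time 1, so equality of terminal expectations is equality of characteristic
functions. -/
theorem map_flow_multivariateGaussian (hp : IsProbDensity p₀) (ht : GaussianTail C A h p₀)
    (hC : C.PosDef)
    (hmoment : Integrable (fun x : EuclideanSpace ℝ (Fin d) => ‖x‖ ^ 3) (law p₀))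
    {Φ : ℝ → EuclideanSpace ℝ (Fin d) → ℝ → EuclideanSpace ℝ (Fin d)}
    (hΦ : IsFlow (extendedDrift (act C⁻¹) (act A⁻¹) h (gradient h)) Φ)
    (hm : Measurable fun x => Φ 0 x 1) :
    (multivariateGaussian 0 C).map (fun x => Φ 0 x 1) = law p₀ := by
  obtain ⟨M, N, hh⟩ := ht.exists_hasTameGradient hC
  obtain ⟨β, hP, hQ⟩ := exists_isCoerciveSymm_inv_inv hC ht.posDef
  obtain ⟨K, hK⟩ := exists_lipschitzWith_extendedDrift hh hP hQ
  have := hp.isProbabilityMeasure_law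
  have : IsProbabilityMeasure ((multivariateGaussian 0 C).map fun x => Φ 0 x 1) :=
    Measure.isProbabilityMeasure_map hm.aemeasurable
  have hX : IsDriftedCurve ((law p₀).prod (multivariateGaussian 0 C))
      (extendedDrift (act C⁻¹) (act A⁻¹) h (gradient h)) interpolation interpolationDeriv ℂ := by
    refine isDriftedCurve_interpolation ((memLp_two_law hp hmoment).comp_fst _)
      ((IsGaussian.memLp_two_id (μ := multivariateGaussian 0 C)).comp_snd _)
      fun t ht' ψ hψ hψb => ?_
    rw [integral_interpolation_drift hp ht hC hmoment ht' hψ hψb]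
    simp only [extendedDrift_of_mem (Ico_subset_Icc_self ht')]
  refine Measure.ext_of_charFun ?_
  ext ξ
  have hf : Continuous fun x : EuclideanSpace ℝ (Fin d) =>
    Complex.exp ((inner ℝ x ξ : ℝ) * Complex.I) := by fun_prop
  have key := integral_terminal_eq hΦ (continuous_extendedDrift hh hP hQ) hK
    (norm_extendedDrift_zero_le hh hP hQ) hX (norm_nonneg ξ) (norm_exp_inner_mul_I_sub_le ξ)
    (M := 1) fun x => (Complex.norm_exp_ofReal_mul_I _).le
  have e1 : ∀ ω : EuclideanSpace ℝ (Fin d) × EuclideanSpace ℝ (Fin d),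
      interpolation 1 ω = ω.1 := fun ω => by simp [interpolation]
  have e0 : ∀ ω : EuclideanSpace ℝ (Fin d) × EuclideanSpace ℝ (Fin d),
      interpolation 0 ω = ω.2 := fun ω => by simp [interpolation]
  simp only [e1, e0] at key
  rw [charFun_apply, charFun_apply, integral_map hm.aemeasurable hf.aestronglyMeasurable]
  have k1 := integral_fun_fst (μ := law p₀) (ν := multivariateGaussian 0 C)
    (fun x : EuclideanSpace ℝ (Fin d) => Complex.exp ((inner ℝ x ξ : ℝ) * Complex.I))
  have k2 := integral_fun_snd (μ := law p₀) (ν := multivariateGaussian 0 C)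
    (fun x : EuclideanSpace ℝ (Fin d) => Complex.exp ((inner ℝ (Φ 0 x 1) ξ : ℝ) * Complex.I))
  rw [k1, k2] at key
  simpa using key.symm

end Transport

end Follmer

theorem lemma3p9 {d : ℕ} (C A : Matrix (Fin d) (Fin d) ℝ)
    (h p₀ : EuclideanSpace ℝ (Fin d) → ℝ) (hC : C.PosDef)
    (hp₀ : Follmer.IsProbDensity p₀)
    (hmoment : Integrable (fun x : EuclideanSpace ℝ (Fin d) => ‖x‖ ^ 3) (Follmer.law p₀))
    (htail : Follmer.GaussianTail C A h p₀) :
    -- the density is positive and differentiable, so that the score is well defined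
    (∀ t ∈ Ioc (0 : ℝ) 1, ∀ x, 0 < Follmer.reverseDensity C p₀ t x ∧
      DifferentiableAt ℝ (Follmer.reverseDensity C p₀ t) x) ∧
    -- the limit of the velocity field at `t = 0`
    (∀ x, Tendsto (fun t : ℝ => t⁻¹ • (x + Follmer.score C p₀ t x)) (𝓝[>] 0)
      (𝓝 (∫ y, y ∂(Follmer.law p₀)))) ∧
    -- the extended velocity field is jointly continuous at `t = 0`
    (∀ x, ContinuousWithinAt
      (fun q : ℝ × EuclideanSpace ℝ (Fin d) => Follmer.velocity C p₀ q.1 q.2)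
      (Icc 0 1 ×ˢ univ) (0, x)) ∧
    -- the flow exists, is unique, and transports `N(0, C)` to the target law
    ∃ X : ℝ → EuclideanSpace ℝ (Fin d) → EuclideanSpace ℝ (Fin d),
      (∀ x, Follmer.IsFollmerSolution C p₀ x (fun t => X t x)) ∧
      (∀ x (Y : ℝ → EuclideanSpace ℝ (Fin d)), Follmer.IsFollmerSolution C p₀ x Y →
        ∀ t ∈ Icc (0 : ℝ) 1, Y t = X t x) ∧
      Measurable (X 1) ∧
      (multivariateGaussian 0 C).map (X 1) = Follmer.law p₀ := by
  obtain ⟨M, N, hh⟩ := htail.exists_hasTameGradient hC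
  obtain ⟨β, hP, hQ⟩ := Follmer.exists_isCoerciveSymm_inv_inv hC htail.posDef
  obtain ⟨K, hK⟩ := Follmer.exists_lipschitzWith_extendedDrift hh hP hQ
  have hv := Follmer.continuous_extendedDrift hh hP hQ
  have h0 : (0 : ℝ) ∈ Icc (0 : ℝ) 1 := left_mem_Icc.2 zero_le_one
  have h1 : (1 : ℝ) ∈ Icc (0 : ℝ) 1 := right_mem_Icc.2 zero_le_one
  -- Everything reduces to this identity: the limit at 0, joint continuity, and the flow are
  -- properties of the continuous, uniformly Lipschitz field on the right.
  have hvel : ∀ t ∈ Icc (0 : ℝ) 1, ∀ x, Follmer.velocity C p₀ t x = Follmer.extendedDrift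
      (Follmer.act C⁻¹) (Follmer.act A⁻¹) h (gradient h) t x := fun t ht x => by
    rw [Follmer.extendedDrift_of_mem ht, Follmer.velocity_eq_drift hp₀ htail hC ht]
  obtain ⟨Φ, hΦ⟩ := Follmer.exists_isFlow hv hK (Follmer.norm_extendedDrift_zero_le hh hP hQ)
  have hmeas : Measurable fun x => Φ 0 x 1 :=
    (Follmer.continuous_of_norm_sub_le (hΦ.norm_sub_le hK h0 h1)).measurable
  refine ⟨fun t ht x => ⟨Follmer.reverseDensity_pos htail hC (Ioc_subset_Icc_self ht) x,
    Follmer.differentiableAt_reverseDensity htail hC (Ioc_subset_Icc_self ht) x⟩, fun x => ?_,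
    fun x => ?_, fun t x => Φ 0 x t, fun x => ⟨hΦ.init 0 h0 x, fun t ht => ?_⟩,
    fun x Y hY t ht => ?_, hmeas,
    Follmer.map_flow_multivariateGaussian hp₀ htail hC hmoment hΦ hmeas⟩
  · have h2 : Tendsto (fun t : ℝ => Follmer.extendedDrift (Follmer.act C⁻¹) (Follmer.act A⁻¹) h
        (gradient h) t x) (𝓝[>] 0) (𝓝 (Follmer.extendedDrift (Follmer.act C⁻¹) (Follmer.act A⁻¹) h
        (gradient h) 0 x)) :=
      ((hv.comp (Continuous.prodMk_left x)).tendsto 0).mono_left nhdsWithin_le_nhds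
    rw [← hvel 0 h0, Follmer.velocity, if_pos rfl] at h2
    refine h2.congr' ?_
    filter_upwards [Ioc_mem_nhdsGT (zero_lt_one' ℝ)] with t ht
    rw [← hvel t (Ioc_subset_Icc_self ht), Follmer.velocity, if_neg ht.1.ne']
  · exact hv.continuousWithinAt.congr (fun q hq => hvel q.1 hq.1 q.2) (hvel 0 h0 x)
  · rw [hvel t ht]
    exact hΦ.deriv 0 h0 x t ht
  · refine Follmer.eqOn_of_solutions hK (fun s hs => ?_) (hΦ.deriv 0 h0 x)
      (hY.1.trans (hΦ.init 0 h0 x).symm) ht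
    rw [← hvel s hs]
    exact hY.2 s hs
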